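/- Let $F$ be a field of characteristic $\ell\neq 2$ (possibly $\ell=0$), let $V$ be an $F$-vector space of finite dimension $m\ge 2$, and let $f:V\times V\to F$ be a non-degenerate symmetric bilinear form. Let $$L(f)=\{x\in\mathfrak{gl}(V): f(xv,w)=-f(v,xw)\ \forall v,w\in V\},\qquad M(f)=\{y\in\mathfrak{gl}(V): f(yv,w)=f(v,yw)\ \forall v,w\in V\},$$ so that $L(f)$ is a Lie subalgebra of $\mathfrak{gl}(V)$ and $M(f)$ is an $L(f)$-submodule of $\mathfrak{gl}(V)$ under the commutator bracket. Let $\mathfrak{sl}(V)$ be the space of traceless endomorphisms and $\mathfrak{s}$ the space of scalar endomorphisms. Regard $S^2(V)$ and $\Lambda^2(V)$ as the $L(f)$-submodules of $V\otimes V$ spanned by all $v\otimes v$, $v\otimes w+w\otimes v$, respectively by all $v\otimes w-w\otimes v$, and write $vw=\frac12(v\otimes w+w\otimes v)\in S^2(V)$. Then: (1) $M(f)$ is the orthogonal complement of $L(f)$ with respect to the bilinear form $\varphi(x,y)=\mathrm{tr}(xy)$ on $\mathfrak{gl}(V)$. There is a basis of $V$ relative to which $f$ has Gram matrix $D=\mathrm{diag}(d_1,\dots,d_m)$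 and, relative to this basis, $M(f)$ consists of all $A\in\mathfrak{gl}(m)$ such that $d_iA_{ij}=d_jA_{ji}$ for all $i,j$. Furthermore, $M(f)\cong S^2(V)$ as $L(f)$-modules. (2) Relative to the same basis, $M(f)\cap\mathfrak{sl}(V)$ consists of all $A\in\mathfrak{gl}(m)$ such that $d_iA_{ij}=d_jA_{ji}$ for all $i,j$ and $\mathrm{tr}(A)=0$. The restriction to $S^2(V)$ of the contraction $V\otimes V\to F$, $v\otimes w\mapsto f(v,w)$, is an $L(f)$-epimorphism $S^2(V)\to F$ onto the trivial module with $vw\mapsto f(v,w)$, and $M(f)\cap\mathfrak{sl}(V)$ is isomorphic to its kernel as an $L(f)$-module. (3) If $m\ge4$ and $\ell\nmid m$, then $M(f)\cap\mathfrak{sl}(V)$ is an irreducible $L(f)$-module of dimension $\binom{m+1}{2}-1$. (4) If $m\ge4$ and $\ell\mid m$, then $\mathfrak{s}\subseteq M(f)\cap\mathfrak{sl}(V)$ and $(M(f)\cap\mathfrak{sl}(V))/\mathfrak{s}$ is an irreducible $L(f)$-module of dimension $\binom{m+1}{2}-2$. (5) If $m=3$ or $m\ge5$, then $L(f)$ is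 a simple Lie algebra, isomorphic to both $\mathfrak{gl}(V)/M(f)$ and $\Lambda^2(V)$ as $L(f)$-modules. (6) Suppose that $m\ge5$, or that $m=4$ and the discriminant of $f$ (the determinant of a Gram matrix of $f$) is not a square in $F$. Then $$0\subset\mathfrak{s}\subset M(f)\cap\mathfrak{sl}(V)\subset M(f)\subset\mathfrak{gl}(V)\quad\text{if }\ell\mid m,$$ $$0\subset M(f)\cap\mathfrak{sl}(V)\subset M(f)\subset\mathfrak{gl}(V)\quad\text{if }\ell\nmid m$$ is a composition series of the $L(f)$-module $\mathfrak{gl}(V)$. For every $m\ge2$, $M(f)/(M(f)\cap\mathfrak{sl}(V))$ is isomorphic to the trivial $L(f)$-module $F$. -/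

import Mathlib

open scoped TensorProduct

attribute [local instance 100] LieRing.ofAssociativeRing

noncomputable section

namespace OrthogonalGl

variable {F : Type*} [Field F] {V : Type*} [AddCommGroup V] [Module F V]

/-- `L(f)`, the Lie subalgebra of `gl(V) = Module.End F V` (with bracket `xy - yx`) consisting of
the endomorphisms that are skew-adjoint with respect to `f`. -/
abbrev L (f : LinearMap.BilinForm F V) : LieSubalgebra F (Module.End F V) :=
  skewAdjointLieSubalgebra f

theorem mem_L {f : LinearMap.BilinForm F V} {x : Module.End F V} :
    x ∈ L f ↔ ∀ v w, f (x v) w = -f v (x w) := by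
  change x ∈ f.skewAdjointSubmodule ↔ _
  simp [LinearMap.mem_skewAdjointSubmodule, LinearMap.IsSkewAdjoint, LinearMap.IsAdjointPair]

theorem lie_V {f : LinearMap.BilinForm F V} (x : L f) (v : V) :
    ⁅x, v⁆ = (x : Module.End F V) v := rfl

theorem lie_gl {f : LinearMap.BilinForm F V} (x : L f) (y : Module.End F V) :
    ⁅x, y⁆ = (x : Module.End F V) * y - y * (x : Module.End F V) := rfl

theorem lie_tmul {f : LinearMap.BilinForm F V} (x : L f) (v w : V) :
    ⁅x, v ⊗ₜ[F] w⁆ = (x : Module.End F V) v ⊗ₜ[F] w + v ⊗ₜ[F] (x : Module.End F V) w :=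
  TensorProduct.LieModule.lie_tmul_right (R := F) (L := Module.End F V) (x : Module.End F V) v w

/-- `M(f)`, the `L(f)`-submodule of `gl(V)` of the endomorphisms that are self-adjoint with
respect to `f`. -/
def M (f : LinearMap.BilinForm F V) : LieSubmodule F (L f) (Module.End F V) where
  carrier := {y | ∀ v w, f (y v) w = f v (y w)}
  add_mem' := by
    intro a b ha hb v w
    simp [ha v w, hb v w]
  zero_mem' := by
    intro v w
    simp
  smul_mem' := by
    intro c a ha v w
    simp [ha v w]
  lie_mem := by
    intro x y hy v w
    have hx := mem_L.1 x.2
    have hy' : ∀ v w, f (y v) w = f v (y w) := hy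
    rw [lie_gl]
    simp only [LinearMap.sub_apply, Module.End.mul_apply, map_sub, hx, hy']
    ring

/-- `sl(V)`, the traceless endomorphisms, as an `L(f)`-submodule of `gl(V)`. -/
def sl (f : LinearMap.BilinForm F V) : LieSubmodule F (L f) (Module.End F V) where
  __ := LinearMap.ker (LinearMap.trace F V)
  lie_mem := by
    intro x y _
    change LinearMap.trace F V ⁅x, y⁆ = 0
    rw [lie_gl, map_sub, LinearMap.trace_mul_comm, sub_self]

/-- The scalar endomorphisms, as an `L(f)`-submodule of `gl(V)`. -/
def scalars (f : LinearMap.BilinForm F V) : LieSubmodule F (L f) (Module.End F V) where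
  __ := Submodule.span F {(1 : Module.End F V)}
  lie_mem := by
    intro x y hy
    obtain ⟨c, rfl⟩ := Submodule.mem_span_singleton.1 hy
    rw [lie_gl]
    simp

/-- The bilinear form `(x, y) ↦ tr (xy)` on `gl(V)`. -/
def trForm (F V : Type*) [Field F] [AddCommGroup V] [Module F V] :
    LinearMap.BilinForm F (Module.End F V) :=
  (LinearMap.mul F (Module.End F V)).compr₂ (LinearMap.trace F V)

/-- The symmetric square `S²(V)`, as the `L(f)`-submodule of `V ⊗ V` spanned by all `v ⊗ v` and
all `v ⊗ w + w ⊗ v`. -/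
def symSq (f : LinearMap.BilinForm F V) : LieSubmodule F (L f) (V ⊗[F] V) where
  __ := Submodule.span F
    ({t | ∃ v : V, t = v ⊗ₜ[F] v} ∪ {t | ∃ v w : V, t = v ⊗ₜ[F] w + w ⊗ₜ[F] v})
  lie_mem := by
    intro x t ht
    change t ∈ Submodule.span F _ at ht
    change ⁅x, t⁆ ∈ Submodule.span F _
    induction ht using Submodule.span_induction with
    | mem t ht =>
      rcases ht with ⟨v, rfl⟩ | ⟨v, w, rfl⟩
      · rw [lie_tmul]
        exact Submodule.subset_span (Or.inr ⟨_, _, rfl⟩)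
      · rw [lie_add, lie_tmul,
          lie_tmul, add_comm ((x : Module.End F V) w ⊗ₜ[F] v), add_add_add_comm]
        exact Submodule.add_mem _ (Submodule.subset_span (Or.inr ⟨_, _, rfl⟩))
          (Submodule.subset_span (Or.inr ⟨_, _, rfl⟩))
    | zero => simp
    | add a b _ _ ha hb => rw [lie_add]; exact Submodule.add_mem _ ha hb
    | smul c a _ ha => rw [lie_smul]; exact Submodule.smul_mem _ c ha

/-- The exterior square `Λ²(V)`, as the `L(f)`-submodule of `V ⊗ V` spanned by all
`v ⊗ w - w ⊗ v`. -/
def extSq (f : LinearMap.BilinForm F V) : LieSubmodule F (L f) (V ⊗[F] V) where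
  __ := Submodule.span F {t | ∃ v w : V, t = v ⊗ₜ[F] w - w ⊗ₜ[F] v}
  lie_mem := by
    intro x t ht
    change t ∈ Submodule.span F _ at ht
    change ⁅x, t⁆ ∈ Submodule.span F _
    induction ht using Submodule.span_induction with
    | mem t ht =>
      obtain ⟨v, w, rfl⟩ := ht
      rw [lie_sub, lie_tmul,
        lie_tmul, add_comm ((x : Module.End F V) w ⊗ₜ[F] v), add_sub_add_comm]
      exact Submodule.add_mem _ (Submodule.subset_span ⟨_, _, rfl⟩)
        (Submodule.subset_span ⟨_, _, rfl⟩)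
    | zero => simp
    | add a b _ _ ha hb => rw [lie_add]; exact Submodule.add_mem _ ha hb
    | smul c a _ ha => rw [lie_smul]; exact Submodule.smul_mem _ c ha

/-- The product `vw` in `S²(V)`, i.e. the symmetrization `(v ⊗ w + w ⊗ v) / 2` of `v ⊗ w`.
Only meaningful when `2 ≠ 0` in `F`. -/
def symMul (f : LinearMap.BilinForm F V) (v w : V) : symSq f :=
  ⟨(2 : F)⁻¹ • (v ⊗ₜ[F] w + w ⊗ₜ[F] v),
    Submodule.smul_mem _ _ (Submodule.subset_span (Or.inr ⟨v, w, rfl⟩))⟩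

/-- The trivial `L(f)`-module `F`. -/
abbrev Triv (f : LinearMap.BilinForm F V) : Type _ := TrivialLieModule F (L f) F

/-- The contraction `V ⊗ V → F`, `v ⊗ w ↦ f(v, w)`, as an `L(f)`-homomorphism to the trivial
module. -/
def contraction (f : LinearMap.BilinForm F V) : (V ⊗[F] V) →ₗ⁅F, L f⁆ Triv f where
  __ := (TrivialLieModule.equiv F (L f) F).symm.toLinearMap ∘ₗ TensorProduct.lift f
  map_lie' := by
    intro x t
    change TensorProduct.lift f ⁅x, t⁆ = (0 : F)
    induction t using TensorProduct.induction_on with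
    | zero => simp
    | tmul v w =>
      rw [lie_tmul, map_add, TensorProduct.lift.tmul,
        TensorProduct.lift.tmul, mem_L.1 x.2]
      ring
    | add a b ha hb => rw [lie_add, map_add, ha, hb, add_zero]

/-- The restriction `S²(V) → F` of the contraction. -/
def symContraction (f : LinearMap.BilinForm F V) : symSq f →ₗ⁅F, L f⁆ Triv f :=
  (contraction f).comp (symSq f).incl

/-- For submodules `U`, `W` of a Lie module (used with `U ≤ W`), the factor module `W / U`. -/
abbrev Factor {R A E : Type*} [CommRing R] [LieRing A] [LieAlgebra R A] [AddCommGroup E]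
    [Module R E] [LieRingModule A E] [LieModule R A E] (U W : LieSubmodule R A E) : Type _ :=
  W ⧸ U.comap W.incl

/-- `0 = W₀ ⊂ W₁ ⊂ ⋯ ⊂ Wₙ = E` is a composition series of the `A`-module `E`: every factor
`Wᵢ₊₁ / Wᵢ` is irreducible (in particular nonzero, so the inclusions are strict). -/
def IsCompSeries {R A E : Type*} [CommRing R] [LieRing A] [LieAlgebra R A] [AddCommGroup E]
    [Module R E] [LieRingModule A E] [LieModule R A E] {n : ℕ}
    (W : Fin (n + 1) → LieSubmodule R A E) : Prop :=
  W 0 = ⊥ ∧ W (Fin.last n) = ⊤ ∧ ∀ i : Fin n, W i.castSucc ≤ W i.succ ∧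
    LieModule.IsIrreducible R A (Factor (W i.castSucc) (W i.succ))

end OrthogonalGl

end

open OrthogonalGl

/-!
Write `x_{v,w}` for the skew-adjoint endomorphism `u ↦ f(w, u) v - f(v, u) w` (`skewOne`).

*Isomorphisms.* The form identifies `V ⊗ V` with `gl(V)` as `L(f)`-modules, `v ⊗ w` going to
`u ↦ f(w, u) v` (`tensorToEnd`). Under this identification the swap of the two factors becomes the
adjoint (`tensorToEnd_adjoint`) and the contraction becomes the trace (`trace_tensorToEnd`). Since
`2` is invertible, `S²(V)` and `Λ²(V)` are the eigenspaces of the swap for `1` and `-1`, so they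
correspond to `M(f)` and `L(f)`, the kernel of the contraction on `S²(V)` corresponds to
`M(f) ∩ sl(V)`, and `gl(V) = M(f) ⊕ L(f)`.

*Irreducibility.* Fix an orthogonal basis `b` with `f(b i, b i) = d i`, and encode an endomorphism
`T` by the matrix `f(b i, T (b j))` (`entries`), symmetric for `T ∈ M(f)` and skew-symmetric for
`T ∈ L(f)`. The action of `x_{b p, b q}` becomes the operator `rotate d p q`. Since the field is
arbitrary, neither weights nor eigenvalues are available (small characteristics make distinct
weights coincide); instead, a product of rotations isolates a single matrix entry:

* for symmetric `t` and distinct `p, q, r, s`, a product of six rotations sends `t` to a nonzero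
  multiple of `t p s • (E p s + E s p)` (`rotate_six_eq`);
* for skew-symmetric `t`, a product of two rotations in dimension three and of four rotations in
  dimension at least five sends `t` to a nonzero multiple of `t p r • (E a b - E b a)` for suitable
  `a ≠ b` (`rotate_skew_three`, `rotate_skew_five`);
* in dimension four a product of four rotations only isolates a combination of `E p r - E r p` and
  `E q s - E s q`. Two more rotations map this plane to itself by an operator whose square is the
  scalar `∏ i, d i`. If the discriminant is not a square, this operator has no eigenvector, so that
  the whole plane is reached (`mem_of_skew_ne_zero`).

A symmetric matrix without off-diagonal entries is sent to a nonzero multiple of some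
`E p q + E q p` by one rotation, unless it represents a scalar. A single `E p q + E q p`, or
`E p q - E q p`, in turn generates all traceless symmetric, or all skew-symmetric, matrices
(`mem_of_symUnit_mem`, `mem_of_skewUnit_mem`). Hence every submodule of `gl(V)` with a non-scalar
element of `M(f)` contains `M(f) ∩ sl(V)` (`M_inf_sl_le`), and every submodule with a nonzero
element of `L(f)` contains `L(f)` (`mem_of_mem_L`), from which all irreducibility statements follow.
Scalars have trace zero exactly when the characteristic divides the dimension.
-/

namespace OrthogonalGl

/-! ### Rank one endomorphisms and the isomorphism `V ⊗ V ≃ gl(V)` -/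

section RankOne

variable {F : Type*} [Field F] {V : Type*} [AddCommGroup V] [Module F V]

/-- The endomorphism `u ↦ f(w, u) v`, which is the image of `v ⊗ w` under the isomorphism
`V ⊗ V ≃ gl(V)` given by `f`. -/
def rankOne (f : LinearMap.BilinForm F V) (v w : V) : Module.End F V :=
  (f w).smulRight v

@[simp]
theorem rankOne_apply (f : LinearMap.BilinForm F V) (v w u : V) :
    rankOne f v w u = f w u • v := rfl

theorem lie_apply {f : LinearMap.BilinForm F V} (x : L f) (y : Module.End F V) (v : V) :
    ⁅x, y⁆ v = (x : Module.End F V) (y v) - y ((x : Module.End F V) v) := rfl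

theorem lie_rankOne {f : LinearMap.BilinForm F V} (x : L f) (v w : V) :
    ⁅x, rankOne f v w⁆ =
      rankOne f ((x : Module.End F V) v) w + rankOne f v ((x : Module.End F V) w) := by
  ext u
  simp only [lie_apply, rankOne_apply, LinearMap.add_apply, map_smul, mem_L.1 x.2, neg_smul]
  abel

theorem trace_rankOne [FiniteDimensional F V] (f : LinearMap.BilinForm F V) (v w : V) :
    LinearMap.trace F V (rankOne f v w) = f w v := by
  have h : rankOne f v w = dualTensorHom F V V (f w ⊗ₜ[F] v) := by
    ext u
    simp
  rw [h, LinearMap.trace_eq_contract_apply, contractLeft_apply]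

/-- The `L(f)`-homomorphism `V ⊗ V → gl(V)` that sends `v ⊗ w` to `u ↦ f(w, u) v`. -/
def tensorToEnd (f : LinearMap.BilinForm F V) : (V ⊗[F] V) →ₗ⁅F, L f⁆ Module.End F V where
  __ := TensorProduct.lift ((LinearMap.smulRightₗ ∘ₗ f).flip)
  map_lie' := by
    intro x t
    change TensorProduct.lift _ ⁅x, t⁆ = ⁅x, TensorProduct.lift _ t⁆
    induction t using TensorProduct.induction_on with
    | zero => simp
    | tmul v w =>
      rw [lie_tmul, map_add]
      exact (lie_rankOne x v w).symm
    | add a b ha hb => rw [lie_add, map_add, ha, hb, map_add, lie_add]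

@[simp]
theorem tensorToEnd_tmul (f : LinearMap.BilinForm F V) (v w : V) :
    tensorToEnd f (v ⊗ₜ[F] w) = rankOne f v w := rfl

theorem tensorToEnd_bijective [FiniteDimensional F V] {f : LinearMap.BilinForm F V}
    (hf : f.Nondegenerate) : Function.Bijective (tensorToEnd f) := by
  let e : V ⊗[F] V ≃ₗ[F] Module.End F V :=
    TensorProduct.comm F V V ≪≫ₗ
      TensorProduct.congr (f.toDual hf) (LinearEquiv.refl F V) ≪≫ₗ dualTensorHomEquiv F V V
  have h : (tensorToEnd f : V ⊗[F] V →ₗ[F] Module.End F V) = e.toLinearMap := by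
    ext v w u
    simp [e, LinearMap.BilinForm.toDual_def]
  have h' : ⇑(tensorToEnd f) = ⇑e := by
    ext1 t
    exact LinearMap.congr_fun h t
  rw [h']
  exact e.bijective

theorem trace_tensorToEnd [FiniteDimensional F V] {f : LinearMap.BilinForm F V}
    (hsymm : f.IsSymm) (t : V ⊗[F] V) :
    LinearMap.trace F V (tensorToEnd f t) = TrivialLieModule.equiv F (L f) F (contraction f t) := by
  change _ = TensorProduct.lift f t
  induction t using TensorProduct.induction_on with
  | zero => simp
  | tmul v w => simp [trace_rankOne, hsymm.eq w v]
  | add a b ha hb => simp [ha, hb]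

/-- The swap of tensor factors corresponds to taking adjoints. -/
theorem tensorToEnd_adjoint {f : LinearMap.BilinForm F V} (hsymm : f.IsSymm) (t : V ⊗[F] V)
    (v w : V) :
    f (tensorToEnd f t v) w = f v (tensorToEnd f (TensorProduct.comm F V V t) w) := by
  induction t using TensorProduct.induction_on with
  | zero => simp
  | tmul a b => simp [hsymm.eq v b, mul_comm]
  | add a b ha hb => simp [ha, hb]

theorem end_ext {f : LinearMap.BilinForm F V} (hf : f.Nondegenerate) {x y : Module.End F V}
    (h : ∀ v w, f v (x w) = f v (y w)) : x = y := by
  ext w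
  refine sub_eq_zero.1 (hf.2 _ fun v => ?_)
  rw [map_sub, h, sub_self]

theorem mem_M {f : LinearMap.BilinForm F V} {y : Module.End F V} :
    y ∈ M f ↔ ∀ v w, f (y v) w = f v (y w) := Iff.rfl

theorem mem_sl {f : LinearMap.BilinForm F V} {y : Module.End F V} :
    y ∈ sl f ↔ LinearMap.trace F V y = 0 := Iff.rfl

theorem mem_M_inf_sl {f : LinearMap.BilinForm F V} {y : Module.End F V} :
    y ∈ M f ⊓ sl f ↔ (∀ v w, f (y v) w = f v (y w)) ∧ LinearMap.trace F V y = 0 := Iff.rfl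

theorem mem_scalars {f : LinearMap.BilinForm F V} {y : Module.End F V} :
    y ∈ scalars f ↔ ∃ c : F, c • (1 : Module.End F V) = y := Submodule.mem_span_singleton

/-- `S²(V)` consists of the tensors fixed by the swap, as `2` is invertible. -/
theorem mem_symSq_iff {f : LinearMap.BilinForm F V} (h2 : (2 : F) ≠ 0) {t : V ⊗[F] V} :
    t ∈ symSq f ↔ TensorProduct.comm F V V t = t := by
  constructor
  · intro ht
    change t ∈ Submodule.span F _ at ht
    induction ht using Submodule.span_induction with
    | mem t ht =>
      rcases ht with ⟨v, rfl⟩ | ⟨v, w, rfl⟩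
      · simp
      · simp [add_comm]
    | zero => simp
    | add a b _ _ ha hb => rw [map_add, ha, hb]
    | smul c a _ ha => rw [map_smul, ha]
  · intro ht
    have key : ∀ s : V ⊗[F] V, s + TensorProduct.comm F V V s ∈ symSq f := by
      intro s
      induction s using TensorProduct.induction_on with
      | zero => simp
      | tmul v w => exact Submodule.subset_span (Or.inr ⟨v, w, by simp⟩)
      | add a b ha hb =>
        rw [map_add, add_add_add_comm]
        exact add_mem ha hb
    have h := (symSq f).smul_mem (2 : F)⁻¹ (key t)
    rwa [ht, ← two_smul F, inv_smul_smul₀ h2] at h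

/-- `Λ²(V)` consists of the tensors negated by the swap, as `2` is invertible. -/
theorem mem_extSq_iff {f : LinearMap.BilinForm F V} (h2 : (2 : F) ≠ 0) {t : V ⊗[F] V} :
    t ∈ extSq f ↔ TensorProduct.comm F V V t = -t := by
  constructor
  · intro ht
    change t ∈ Submodule.span F _ at ht
    induction ht using Submodule.span_induction with
    | mem t ht =>
      obtain ⟨v, w, rfl⟩ := ht
      simp
    | zero => simp
    | add a b _ _ ha hb => rw [map_add, ha, hb, neg_add]
    | smul c a _ ha => rw [map_smul, ha, smul_neg]
  · intro ht
    have key : ∀ s : V ⊗[F] V, s - TensorProduct.comm F V V s ∈ extSq f := by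
      intro s
      induction s using TensorProduct.induction_on with
      | zero => simp
      | tmul v w => exact Submodule.subset_span ⟨v, w, by simp⟩
      | add a b ha hb =>
        rw [map_add, add_sub_add_comm]
        exact add_mem ha hb
    have h := (extSq f).smul_mem (2 : F)⁻¹ (key t)
    rwa [ht, sub_neg_eq_add, ← two_smul F, inv_smul_smul₀ h2] at h

theorem tensorToEnd_mem_M_iff [FiniteDimensional F V] {f : LinearMap.BilinForm F V}
    (h2 : (2 : F) ≠ 0) (hf : f.Nondegenerate) (hsymm : f.IsSymm) {t : V ⊗[F] V} :
    tensorToEnd f t ∈ M f ↔ t ∈ symSq f := by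
  rw [mem_symSq_iff h2, mem_M]
  simp only [tensorToEnd_adjoint hsymm]
  constructor
  · intro h
    exact (tensorToEnd_bijective hf).1 (end_ext hf h)
  · intro h v w
    rw [h]

theorem tensorToEnd_mem_L_iff [FiniteDimensional F V] {f : LinearMap.BilinForm F V}
    (h2 : (2 : F) ≠ 0) (hf : f.Nondegenerate) (hsymm : f.IsSymm) {t : V ⊗[F] V} :
    tensorToEnd f t ∈ L f ↔ t ∈ extSq f := by
  rw [mem_extSq_iff h2, mem_L]
  simp only [tensorToEnd_adjoint hsymm]
  constructor
  · intro h
    refine (tensorToEnd_bijective hf).1 (end_ext hf fun v w => ?_)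
    rw [h, map_neg, LinearMap.neg_apply, map_neg]
  · intro h v w
    rw [h, map_neg, LinearMap.neg_apply, map_neg]

/-- Every endomorphism is the sum of a self-adjoint and a skew-adjoint one. -/
theorem exists_mem_M_add_mem_L [FiniteDimensional F V] {f : LinearMap.BilinForm F V}
    (h2 : (2 : F) ≠ 0) (hf : f.Nondegenerate) (hsymm : f.IsSymm) (y : Module.End F V) :
    ∃ a ∈ M f, ∃ x : L f, y = a + x := by
  obtain ⟨t, rfl⟩ := (tensorToEnd_bijective hf).2 y
  refine ⟨tensorToEnd f ((2 : F)⁻¹ • (t + TensorProduct.comm F V V t)), ?_,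
    ⟨tensorToEnd f ((2 : F)⁻¹ • (t - TensorProduct.comm F V V t)), ?_⟩, ?_⟩
  · rw [tensorToEnd_mem_M_iff h2 hf hsymm, mem_symSq_iff h2]
    simp [add_comm]
  · rw [tensorToEnd_mem_L_iff h2 hf hsymm, mem_extSq_iff h2]
    simp [← smul_neg]
  · change _ = tensorToEnd f _ + tensorToEnd f _
    rw [← map_add, ← smul_add, add_add_sub_cancel, ← two_smul F, inv_smul_smul₀ h2]

theorem eq_zero_of_mem_M_of_mem_L {f : LinearMap.BilinForm F V} (h2 : (2 : F) ≠ 0)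
    (hf : f.Nondegenerate) {y : Module.End F V} (hM : y ∈ M f) (hL : y ∈ L f) : y = 0 := by
  refine end_ext hf fun v w => ?_
  have h1 := mem_M.1 hM v w
  rw [mem_L.1 hL v w, neg_eq_iff_add_eq_zero, ← two_mul] at h1
  simpa [h2] using h1

/-- The skew-adjoint endomorphism `u ↦ f(w, u) v - f(v, u) w`, the image of `v ⊗ w - w ⊗ v`. -/
def skewOne (f : LinearMap.BilinForm F V) (hsymm : f.IsSymm) (v w : V) : L f :=
  ⟨rankOne f v w - rankOne f w v, mem_L.2 fun a b => by
    simp [hsymm.eq a v, hsymm.eq a w]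
    ring⟩

theorem coe_skewOne (f : LinearMap.BilinForm F V) (hsymm : f.IsSymm) (v w : V) :
    (skewOne f hsymm v w : Module.End F V) = rankOne f v w - rankOne f w v := rfl

/-- The self-adjoint endomorphisms form the orthogonal complement of the skew-adjoint ones:
`tr (x y) = 0` for `x` skew-adjoint and `y` self-adjoint because the trace is invariant under
adjunction, and conversely testing `y` against `skewOne v w` gives `f(y w, v) = f(w, y v)`. -/
theorem M_eq_orthogonal [FiniteDimensional F V] {f : LinearMap.BilinForm F V}
    (h2 : (2 : F) ≠ 0) (hf : f.Nondegenerate) (hsymm : f.IsSymm) :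
    (M f).toSubmodule = (trForm F V).orthogonal (L f).toSubmodule := by
  have key : ∀ v w y, LinearMap.trace F V
      ((rankOne f v w - rankOne f w v) * y) = f w (y v) - f v (y w) := by
    intro v w y
    rw [LinearMap.trace_mul_comm, mul_sub, map_sub]
    have h (a b : V) : y * rankOne f a b = rankOne f (y a) b := by
      ext u
      simp
    rw [h, h, trace_rankOne, trace_rankOne]
  ext y
  rw [LinearMap.BilinForm.mem_orthogonal_iff]
  change y ∈ M f ↔ ∀ x ∈ L f, LinearMap.trace F V (x * y) = 0
  constructor
  · intro hy x hx
    obtain ⟨t, rfl⟩ := (tensorToEnd_bijective hf).2 x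
    rw [tensorToEnd_mem_L_iff h2 hf hsymm] at hx
    change t ∈ Submodule.span F _ at hx
    induction hx using Submodule.span_induction with
    | mem t ht =>
      obtain ⟨v, w, rfl⟩ := ht
      rw [map_sub, tensorToEnd_tmul, tensorToEnd_tmul, key, ← mem_M.1 hy w v, hsymm.eq, sub_self]
    | zero => simp
    | add a b _ _ ha hb => rw [map_add, add_mul, map_add, ha, hb, add_zero]
    | smul c a _ ha => rw [map_smul, smul_mul_assoc, map_smul, ha, smul_zero]
  · intro h v w
    have h1 := h _ (skewOne f hsymm w v).2
    rw [coe_skewOne, key] at h1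
    exact (hsymm.eq (y v) w).trans (sub_eq_zero.1 h1).symm

end RankOne

/-! ### Rotations acting on matrices -/

section Rotation

variable {F : Type*} [Field F] {ι : Type*} [DecidableEq ι]

/-- The action of the generator `u ↦ f(b q, u) b p - f(b p, u) b q` of `L(f)` on the matrix
`t i j = f(b i, T (b j))` of `T ∈ gl(V)`, for a basis `b` with `f(b i, b j) = d i` if `i = j` and
`0` otherwise. -/
def rotate (d : ι → F) (p q : ι) (t : Matrix ι ι F) : Matrix ι ι F := fun i j =>
  (if i = p then d p * t q j else 0) - (if i = q then d q * t p j else 0) +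
    (if j = p then d p * t i q else 0) - (if j = q then d q * t i p else 0)

/-- The symmetric matrix `E p q + E q p`. -/
def symUnit (F : Type*) [Field F] (p q : ι) : Matrix ι ι F :=
  Matrix.single p q 1 + Matrix.single q p 1

/-- The skew-symmetric matrix `E p q - E q p`. -/
def skewUnit (F : Type*) [Field F] (p q : ι) : Matrix ι ι F :=
  Matrix.single p q 1 - Matrix.single q p 1

theorem symUnit_apply (p q i j : ι) : symUnit F p q i j =
    (if i = p ∧ j = q then 1 else 0) + (if i = q ∧ j = p then 1 else 0) := by
  simp [symUnit, Matrix.single_apply, eq_comm]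

theorem skewUnit_apply (p q i j : ι) : skewUnit F p q i j =
    (if i = p ∧ j = q then 1 else 0) - (if i = q ∧ j = p then 1 else 0) := by
  simp [skewUnit, Matrix.single_apply, eq_comm]

/-- Rotations in two disjoint planes leave only the entries that link one plane to the other. -/
theorem rotate_rotate_apply {d : ι → F} {p q r s : ι} (hpq : p ≠ q) (hpr : p ≠ r) (hps : p ≠ s)
    (hqr : q ≠ r) (hqs : q ≠ s) (hrs : r ≠ s) (t : Matrix ι ι F) (i j : ι) :
    rotate d p q (rotate d r s t) i j =
      if i = p then (if j = r then d p * d r * t q s else if j = s then -(d p * d s * t q r) else 0)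
      else if i = q then
        (if j = r then -(d q * d r * t p s) else if j = s then d q * d s * t p r else 0)
      else if i = r then
        (if j = p then d p * d r * t s q else if j = q then -(d q * d r * t s p) else 0)
      else if i = s then
        (if j = p then -(d p * d s * t r q) else if j = q then d q * d s * t r p else 0)
      else 0 := by
  simp only [rotate]
  grind

/-- Rotations in the disjoint planes `{p, q}` and `{r, s}`, followed by rotations in the disjoint
planes `{p, r}` and `{q, s}`, cut a matrix down to its entries at `(p, s)`, `(q, r)` and the
transposed positions. -/
theorem rotate_four_apply {d : ι → F} {p q r s : ι} (hpq : p ≠ q) (hpr : p ≠ r) (hps : p ≠ s)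
    (hqr : q ≠ r) (hqs : q ≠ s) (hrs : r ≠ s) (t : Matrix ι ι F) (i j : ι) :
    rotate d p r (rotate d q s (rotate d p q (rotate d r s t))) i j =
      if (i = p ∧ j = s) ∨ (i = s ∧ j = p) ∨ (i = q ∧ j = r) ∨ (i = r ∧ j = q) then
        d p * d q * d r * d s * t j i else 0 := by
  rw [rotate_rotate_apply hpr hpq hps hqr.symm hrs hqs]
  simp only [rotate_rotate_apply hpq hpr hps hqr hqs hrs]
  grind

/-- A product of six rotations isolates the entry of a symmetric matrix at `(p, s)`. After the first
four, only `(p, s)`, `(q, r)` and the transposed positions survive, and the rotation in the plane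
`{p, s}` annihilates the part at `(q, r)`. -/
theorem rotate_six_eq {d : ι → F} {p q r s : ι} (hpq : p ≠ q) (hpr : p ≠ r) (hps : p ≠ s)
    (hqr : q ≠ r) (hqs : q ≠ s) (hrs : r ≠ s) {t : Matrix ι ι F} (ht : ∀ i j, t i j = t j i) :
    rotate d p s (rotate d p s (rotate d p r (rotate d q s (rotate d p q (rotate d r s t))))) =
      (-4 * d p ^ 2 * d q * d r * d s ^ 2 * t p s) • symUnit F p s := by
  have h : rotate d p s (rotate d p r (rotate d q s (rotate d p q (rotate d r s t)))) =
      Matrix.single p p (2 * d p ^ 2 * d q * d r * d s * t p s) -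
        Matrix.single s s (2 * d p * d q * d r * d s ^ 2 * t p s) := by
    ext i j
    simp only [rotate.eq_def d p s, rotate_four_apply hpq hpr hps hqr hqs hrs,
      Matrix.sub_apply, Matrix.single_apply]
    grind
  rw [h]
  ext i j
  simp only [rotate, Matrix.sub_apply, Matrix.single_apply, Matrix.smul_apply, symUnit_apply,
    smul_eq_mul]
  grind

theorem rotate_diagonal {d : ι → F} {p q : ι} (hpq : p ≠ q) {t : Matrix ι ι F}
    (ht : ∀ i j, i ≠ j → t i j = 0) :
    rotate d p q t = (d p * t q q - d q * t p p) • symUnit F p q := by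
  ext i j
  simp only [rotate, Matrix.smul_apply, symUnit_apply, smul_eq_mul]
  grind

theorem rotate_symUnit {d : ι → F} {p q r : ι} (hpq : p ≠ q) (hrp : r ≠ p) (hrq : r ≠ q) :
    rotate d r p (symUnit F p q) = d r • symUnit F r q := by
  ext i j
  simp only [rotate, Matrix.smul_apply, symUnit_apply, smul_eq_mul]
  grind

theorem rotate_symUnit_self {d : ι → F} {p q : ι} (hpq : p ≠ q) :
    rotate d p q (symUnit F p q) =
      (2 : F) • (Matrix.single p p (d p) - Matrix.single q q (d q)) := by
  ext i j
  simp only [rotate, Matrix.smul_apply, Matrix.sub_apply, Matrix.single_apply, symUnit_apply,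
    smul_eq_mul]
  grind

theorem rotate_skewUnit {d : ι → F} {p q r : ι} (hpq : p ≠ q) (hrp : r ≠ p) (hrq : r ≠ q) :
    rotate d r p (skewUnit F p q) = d r • skewUnit F r q := by
  ext i j
  simp only [rotate, Matrix.smul_apply, skewUnit_apply, smul_eq_mul]
  grind

theorem rotate_skew_three {d : ι → F} {p q r : ι} (hpq : p ≠ q) (hpr : p ≠ r) (hqr : q ≠ r)
    (huniv : ∀ i, i = p ∨ i = q ∨ i = r) {t : Matrix ι ι F} (h0 : ∀ i, t i i = 0)
    (ht : ∀ i j, t i j = -t j i) :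
    rotate d p r (rotate d p q t) = (d p * d q * t p r) • skewUnit F p q := by
  have h1 := ht r p
  have h2 := ht q p
  have h3 := ht r q
  ext i j
  simp only [Matrix.smul_apply, skewUnit_apply, smul_eq_mul]
  rcases huniv i with rfl | rfl | rfl <;> rcases huniv j with rfl | rfl | rfl <;>
    simp [rotate, h0, h1, h2, h3, hpq, hpr, hqr, hpq.symm, hpr.symm, hqr.symm] <;> ring

theorem rotate_skew_five {d : ι → F} {p q r s w : ι} (hpq : p ≠ q) (hpr : p ≠ r) (hps : p ≠ s)
    (hqr : q ≠ r) (hqs : q ≠ s) (hrs : r ≠ s) (hwp : w ≠ p) (hwq : w ≠ q) (hwr : w ≠ r)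
    (hws : w ≠ s) {t : Matrix ι ι F} (ht : ∀ i j, t i j = -t j i) :
    rotate d s p (rotate d q w (rotate d p q (rotate d r s t))) =
      (-(d p * d q * d s * d w * t p r)) • skewUnit F p w := by
  ext i j
  simp only [rotate.eq_def d q w, rotate.eq_def d s p, rotate_rotate_apply hpq hpr hps hqr hqs hrs,
    Matrix.smul_apply, skewUnit_apply, smul_eq_mul]
  grind

theorem rotate_skew_four {d : ι → F} {p q r s : ι} (hpq : p ≠ q) (hpr : p ≠ r) (hps : p ≠ s)
    (hqr : q ≠ r) (hqs : q ≠ s) (hrs : r ≠ s) {t : Matrix ι ι F} (ht : ∀ i j, t i j = -t j i) :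
    rotate d p r (rotate d q s (rotate d p q (rotate d r s t))) =
      (-(d p * d q * d r * d s)) • (t p s • skewUnit F p s + t q r • skewUnit F q r) := by
  ext i j
  rw [rotate_four_apply hpq hpr hps hqr hqs hrs]
  simp only [Matrix.smul_apply, Matrix.add_apply, skewUnit_apply, smul_eq_mul]
  grind

/-- The rotations in `{p, q}` and `{r, s}` interchange the lines of `skewUnit p s` and
`skewUnit q r`. -/
theorem rotate_rotate_skewUnit {d : ι → F} {p q r s : ι} (hpq : p ≠ q) (hpr : p ≠ r) (hps : p ≠ s)
    (hqr : q ≠ r) (hqs : q ≠ s) (hrs : r ≠ s) (α β : F) :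
    rotate d p q (rotate d r s (α • skewUnit F p s + β • skewUnit F q r)) =
      (-(d p * d s * β)) • skewUnit F p s + (-(d q * d r * α)) • skewUnit F q r := by
  ext i j
  rw [rotate_rotate_apply hpq hpr hps hqr hqs hrs]
  simp only [Matrix.smul_apply, Matrix.add_apply, skewUnit_apply, smul_eq_mul]
  grind (splits := 20)

end Rotation

/-! ### Subspaces of matrices stable under rotations -/

/-- A symmetric relation on distinct indices that allows changing one index holds for all pairs of
distinct indices as soon as it holds for one. -/
theorem forall_pair_of_move {ι : Type*} {P : ι → ι → Prop} (hswap : ∀ p q, P p q → P q p)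
    (hmove : ∀ p q r, p ≠ q → r ≠ p → r ≠ q → P p q → P r q) {p q : ι} (hpq : p ≠ q)
    (h : P p q) {i j : ι} (hij : i ≠ j) : P i j := by
  have move : ∀ p q r, p ≠ q → r ≠ q → P p q → P r q := by
    intro p q r hpq hrq h
    rcases eq_or_ne r p with rfl | hrp
    · exact h
    · exact hmove p q r hpq hrp hrq h
  rcases eq_or_ne i q with rfl | hiq
  · exact hswap _ _ (move _ _ _ hpq hij.symm h)
  · exact hswap _ _ (move _ _ _ hiq.symm hij.symm (hswap _ _ (move _ _ _ hpq hiq h)))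

section Stable

variable {F : Type*} [Field F] {ι : Type*} [DecidableEq ι]

theorem exists_notMem_of_card_lt [Fintype ι] (S : Finset ι) (h : S.card < Fintype.card ι) :
    ∃ i, i ∉ S := by
  by_contra! hS
  rw [Finset.eq_univ_of_forall hS, Finset.card_univ] at h
  exact lt_irrefl _ h

variable {d : ι → F} {N : Submodule F (Matrix ι ι F)}

theorem mem_of_skewUnit_mem [Fintype ι] (h2 : (2 : F) ≠ 0) (hd : ∀ i, d i ≠ 0)
    (hN : ∀ p q, ∀ t ∈ N, rotate d p q t ∈ N) {p q : ι} (hpq : p ≠ q) (h : skewUnit F p q ∈ N)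
    {s : Matrix ι ι F} (hs : ∀ i j, s i j = -s j i) : s ∈ N := by
  have hall : ∀ i j, i ≠ j → skewUnit F i j ∈ N := by
    intro i j hij
    refine forall_pair_of_move (P := fun i j => skewUnit F i j ∈ N) ?_ ?_ hpq h hij
    · intro p q h
      have : skewUnit F q p = -skewUnit F p q := by simp [skewUnit]
      rw [this]
      exact N.neg_mem h
    · intro p q r hpq hrp hrq h
      have := hN r p _ h
      rwa [rotate_skewUnit hpq hrp hrq, N.smul_mem_iff (hd r)] at this
  have hs' : (2 : F) • s = ∑ i, ∑ j, s i j • skewUnit F i j := by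
    have h1 : ∑ i, ∑ j, s i j • (Matrix.single i j 1 : Matrix ι ι F) = s := by
      conv_rhs => rw [Matrix.matrix_eq_sum_single s]
      simp
    have h3 : ∑ i, ∑ j, s i j • (Matrix.single j i 1 : Matrix ι ι F) = -s := by
      rw [Finset.sum_comm]
      conv_rhs => rw [← h1]
      rw [← Finset.sum_neg_distrib]
      refine Finset.sum_congr rfl fun i _ => ?_
      rw [← Finset.sum_neg_distrib]
      refine Finset.sum_congr rfl fun j _ => ?_
      rw [hs j i, neg_smul]
    simp only [skewUnit, smul_sub, Finset.sum_sub_distrib, h1, h3]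
    rw [sub_neg_eq_add, two_smul]
  rw [← N.smul_mem_iff h2, hs']
  refine N.sum_mem fun i _ => N.sum_mem fun j _ => ?_
  rcases eq_or_ne i j with rfl | hij
  · simp [skewUnit]
  · exact N.smul_mem _ (hall i j hij)

theorem mem_of_symUnit_mem [Fintype ι] (h2 : (2 : F) ≠ 0) (hd : ∀ i, d i ≠ 0)
    (hN : ∀ p q, ∀ t ∈ N, rotate d p q t ∈ N) {p q : ι} (hpq : p ≠ q) (h : symUnit F p q ∈ N)
    {s : Matrix ι ι F} (hs : ∀ i j, s i j = s j i) (htr : ∑ i, (d i)⁻¹ * s i i = 0) : s ∈ N := by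
  have hall : ∀ i j, i ≠ j → symUnit F i j ∈ N := by
    intro i j hij
    refine forall_pair_of_move (P := fun i j => symUnit F i j ∈ N) ?_ ?_ hpq h hij
    · intro p q h
      have : symUnit F q p = symUnit F p q := by simp [symUnit, add_comm]
      rwa [this]
    · intro p q r hpq hrp hrq h
      have := hN r p _ h
      rwa [rotate_symUnit hpq hrp hrq, N.smul_mem_iff (hd r)] at this
  have hdiag : ∀ i j, (Matrix.single i i (d i) - Matrix.single j j (d j) : Matrix ι ι F) ∈ N := by
    intro i j
    rcases eq_or_ne i j with rfl | hij
    · simp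
    · have := hN i j _ (hall i j hij)
      rwa [rotate_symUnit_self hij, N.smul_mem_iff h2] at this
  -- Subtracting a fixed diagonal unit from every diagonal term changes nothing, by `htr`.
  have hs' : (2 : F) • s = ∑ i, ∑ j, s i j •
      (symUnit F i j - if i = j then (2 * (d i)⁻¹) • Matrix.single p p (d p) else 0) := by
    have h1 : ∑ i, ∑ j, s i j • (Matrix.single i j 1 : Matrix ι ι F) = s := by
      conv_rhs => rw [Matrix.matrix_eq_sum_single s]
      simp
    have h3 : ∑ i, ∑ j, s i j • (Matrix.single j i 1 : Matrix ι ι F) = s := by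
      rw [Finset.sum_comm]
      conv_rhs => rw [← h1]
      refine Finset.sum_congr rfl fun i _ => Finset.sum_congr rfl fun j _ => ?_
      rw [hs j i]
    have h4 : ∑ i, ∑ j, s i j •
        (if i = j then (2 * (d i)⁻¹) • (Matrix.single p p (d p) : Matrix ι ι F) else 0) = 0 := by
      simp only [smul_ite, smul_zero, Finset.sum_ite_eq, Finset.mem_univ, if_true, smul_smul]
      rw [← Finset.sum_smul]
      have : ∑ i, s i i * (2 * (d i)⁻¹) = 2 * ∑ i, (d i)⁻¹ * s i i := by
        rw [Finset.mul_sum]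
        exact Finset.sum_congr rfl fun i _ => by ring
      rw [this, htr, mul_zero, zero_smul]
    simp only [symUnit, smul_sub, smul_add, Finset.sum_sub_distrib, Finset.sum_add_distrib,
      h1, h3, h4]
    rw [sub_zero, two_smul]
  rw [← N.smul_mem_iff h2, hs']
  refine N.sum_mem fun i _ => N.sum_mem fun j _ => N.smul_mem _ ?_
  rcases eq_or_ne i j with rfl | hij
  · have : symUnit F i i - (2 * (d i)⁻¹) • Matrix.single p p (d p) =
        (2 * (d i)⁻¹) • (Matrix.single i i (d i) - Matrix.single p p (d p)) := by
      rw [smul_sub, symUnit, ← two_smul F]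
      simp [Matrix.smul_single, mul_assoc, inv_mul_cancel₀ (hd i)]
    rw [if_pos rfl, this]
    exact N.smul_mem _ (hdiag i p)
  · rw [if_neg hij, sub_zero]
    exact hall i j hij

/-- A rotation-stable space of matrices with a symmetric element that does not represent a scalar
contains all symmetric matrices which represent traceless endomorphisms. -/
theorem mem_of_symm_not_scalar [Fintype ι] (hcard : 4 ≤ Fintype.card ι) (h2 : (2 : F) ≠ 0)
    (hd : ∀ i, d i ≠ 0) (hN : ∀ p q, ∀ t ∈ N, rotate d p q t ∈ N) {t : Matrix ι ι F} (ht : t ∈ N)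
    (hsymm : ∀ i j, t i j = t j i) (hsc : ∀ c : F, t ≠ Matrix.diagonal fun i => c * d i)
    {s : Matrix ι ι F} (hs : ∀ i j, s i j = s j i) (htr : ∑ i, (d i)⁻¹ * s i i = 0) : s ∈ N := by
  suffices h : ∃ p q, p ≠ q ∧ symUnit F p q ∈ N by
    obtain ⟨p, q, hpq, h⟩ := h
    exact mem_of_symUnit_mem h2 hd hN hpq h hs htr
  by_cases hoff : ∃ p s, p ≠ s ∧ t p s ≠ 0
  · obtain ⟨p, s, hps, hne⟩ := hoff
    obtain ⟨q, hq⟩ := exists_notMem_of_card_lt {p, s}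
      (lt_of_le_of_lt Finset.card_le_two (by omega))
    obtain ⟨r, hr⟩ := exists_notMem_of_card_lt {p, s, q}
      (lt_of_le_of_lt Finset.card_le_three (by omega))
    simp only [Finset.mem_insert, Finset.mem_singleton, not_or] at hq hr
    refine ⟨p, s, hps, ?_⟩
    have h := hN p s _ (hN p s _ (hN p r _ (hN q s _ (hN p q _ (hN r s _ ht)))))
    rw [rotate_six_eq (Ne.symm hq.1) (Ne.symm hr.1) hps (Ne.symm hr.2.2) hq.2 hr.2.1 hsymm] at h
    refine (N.smul_mem_iff ?_).1 h
    have h4 : (4 : F) ≠ 0 := by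
      have : (4 : F) = 2 * 2 := by norm_num
      rw [this]
      exact mul_ne_zero h2 h2
    simp [hd, hne, h4]
  · push Not at hoff
    suffices h : ∃ p q, d p * t q q ≠ d q * t p p by
      obtain ⟨p, q, h⟩ := h
      have hpq : p ≠ q := by
        rintro rfl
        exact h rfl
      have h1 := hN p q _ ht
      rw [rotate_diagonal hpq hoff, N.smul_mem_iff (sub_ne_zero.2 h)] at h1
      exact ⟨p, q, hpq, h1⟩
    by_contra! h
    obtain ⟨o⟩ : Nonempty ι := Fintype.card_pos_iff.1 (by omega)
    refine hsc ((d o)⁻¹ * t o o) ?_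
    ext i j
    rcases eq_or_ne i j with rfl | hij
    · rw [Matrix.diagonal_apply_eq]
      have := h o i
      have := hd o
      field_simp
      linear_combination h o i
    · rw [Matrix.diagonal_apply_ne _ hij, hoff i j hij]

/-- A rotation-stable space of matrices with a nonzero skew-symmetric element contains all
skew-symmetric matrices. In dimension four the discriminant enters: two rotations carry
`skewUnit p s` to a multiple of `skewUnit q r` and back, and the square of the resulting operator on
their span is multiplication by the product of the `d i`. -/
theorem mem_of_skew_ne_zero [Fintype ι] (h2 : (2 : F) ≠ 0) (hd : ∀ i, d i ≠ 0)
    (hcard : Fintype.card ι = 3 ∨ 5 ≤ Fintype.card ι ∨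
      (Fintype.card ι = 4 ∧ ¬ IsSquare (∏ i, d i)))
    (hN : ∀ p q, ∀ t ∈ N, rotate d p q t ∈ N) {t : Matrix ι ι F} (ht : t ∈ N)
    (hskew : ∀ i j, t i j = -t j i) (hne : t ≠ 0)
    {s : Matrix ι ι F} (hs : ∀ i j, s i j = -s j i) : s ∈ N := by
  suffices h : ∃ p q, p ≠ q ∧ skewUnit F p q ∈ N by
    obtain ⟨p, q, hpq, h⟩ := h
    exact mem_of_skewUnit_mem h2 hd hN hpq h hs
  have h0 : ∀ i, t i i = 0 := by
    intro i
    have := hskew i i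
    rw [eq_neg_iff_add_eq_zero, ← two_mul] at this
    simpa [h2] using this
  obtain ⟨p, r, hpr, hne⟩ : ∃ p r, p ≠ r ∧ t p r ≠ 0 := by
    by_contra! h
    refine hne ?_
    ext i j
    rcases eq_or_ne i j with rfl | hij
    · exact h0 i
    · exact h i j hij
  obtain ⟨q, hq⟩ := exists_notMem_of_card_lt {p, r}
    (lt_of_le_of_lt Finset.card_le_two (by omega))
  simp only [Finset.mem_insert, Finset.mem_singleton, not_or] at hq
  rcases hcard with hcard | hcard | ⟨hcard, hsq⟩
  · have huniv : ({p, q, r} : Finset ι) = Finset.univ := by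
      rw [← Finset.card_eq_iff_eq_univ, hcard, Finset.card_eq_three]
      exact ⟨p, q, r, Ne.symm hq.1, hpr, hq.2, rfl⟩
    refine ⟨p, q, Ne.symm hq.1, ?_⟩
    have h := hN p r _ (hN p q _ ht)
    rw [rotate_skew_three (Ne.symm hq.1) hpr hq.2 (fun i => by
      simpa using (huniv ▸ Finset.mem_univ i : i ∈ ({p, q, r} : Finset ι))) h0 hskew] at h
    exact (N.smul_mem_iff (by simp [hd, hne])).1 h
  · obtain ⟨s, hs⟩ := exists_notMem_of_card_lt {p, r, q}
      (lt_of_le_of_lt Finset.card_le_three (by omega))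
    obtain ⟨w, hw⟩ := exists_notMem_of_card_lt {p, r, q, s}
      (lt_of_le_of_lt Finset.card_le_four (by omega))
    simp only [Finset.mem_insert, Finset.mem_singleton, not_or] at hs hw
    refine ⟨p, w, Ne.symm hw.1, ?_⟩
    have h := hN s p _ (hN q w _ (hN p q _ (hN r s _ ht)))
    rw [rotate_skew_five (Ne.symm hq.1) hpr (Ne.symm hs.1) hq.2 (Ne.symm hs.2.2) (Ne.symm hs.2.1)
      hw.1 hw.2.2.1 hw.2.1 hw.2.2.2 hskew] at h
    exact (N.smul_mem_iff (by simp [hd, hne])).1 h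
  · obtain ⟨s, hs⟩ := exists_notMem_of_card_lt {p, r, q}
      (lt_of_le_of_lt Finset.card_le_three (by omega))
    simp only [Finset.mem_insert, Finset.mem_singleton, not_or] at hs
    have hpq := Ne.symm hq.1
    have hps := Ne.symm hs.1
    have hqs := Ne.symm hs.2.2
    have hrs := Ne.symm hs.2.1
    have huniv : ({p, q, s, r} : Finset ι) = Finset.univ := by
      rw [← Finset.card_eq_iff_eq_univ, hcard]
      simp [hpq, hps, hpr, hqs, hq.2, hrs.symm]
    have hprod : ∏ i, d i = d p * d q * d s * d r := by
      rw [← huniv]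
      simp [hpq, hps, hpr, hqs, hq.2, hrs.symm, mul_assoc]
    -- `U = α • skewUnit p r + β • skewUnit q s` with `α ≠ 0`, and `U'` is a second element of the
    -- same shape, not proportional to it.
    have hU := hN p s _ (hN q r _ (hN p q _ (hN s r _ ht)))
    rw [rotate_skew_four hpq hps hpr hqs hq.2 hrs.symm hskew,
      N.smul_mem_iff (by simp [hd])] at hU
    have hU' := hN p q _ (hN s r _ hU)
    rw [rotate_rotate_skewUnit hpq hps hpr hqs hq.2 hrs.symm] at hU'
    refine ⟨p, r, hpr, ?_⟩
    have h := N.add_mem (N.smul_mem (t p r * d q * d s) hU) (N.smul_mem (t q s) hU')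
    have key : (t p r * d q * d s) • (t p r • skewUnit F p r + t q s • skewUnit F q s) +
        t q s • (-(d p * d r * t q s) • skewUnit F p r + -(d q * d s * t p r) • skewUnit F q s) =
        (t p r ^ 2 * (d q * d s) - t q s ^ 2 * (d p * d r)) • skewUnit F p r := by
      module
    rw [key] at h
    refine (N.smul_mem_iff fun h0 => hsq ?_).1 h
    rw [hprod]
    refine ⟨t q s * (d p * d r) / t p r, ?_⟩
    field_simp
    linear_combination (d p * d r) * h0

end Stable

/-! ### Coordinates with respect to an orthogonal basis -/

section Coordinates

variable {F : Type*} [Field F] {V : Type*} [AddCommGroup V] [Module F V] {ι : Type*}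

/-- The matrix `(f(b i, T (b j)))` of an endomorphism `T`. It is symmetric (skew-symmetric) exactly
when `T` is self-adjoint (skew-adjoint), unlike the matrix of `T` relative to `b`. -/
noncomputable def entries (f : LinearMap.BilinForm F V) (b : Module.Basis ι F V) :
    Module.End F V →ₗ[F] Matrix ι ι F where
  toFun T := Matrix.of fun i j => f (b i) (T (b j))
  map_add' S T := by
    ext i j
    simp
  map_smul' c T := by
    ext i j
    simp

@[simp]
theorem entries_apply (f : LinearMap.BilinForm F V) (b : Module.Basis ι F V) (T : Module.End F V)
    (i j : ι) : entries f b T i j = f (b i) (T (b j)) := rfl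

theorem forms_eq_iff_basis (b : Module.Basis ι F V) {g h : LinearMap.BilinForm F V} :
    g = h ↔ ∀ i j, g (b i) (b j) = h (b i) (b j) :=
  ⟨fun e i j => by rw [e], LinearMap.BilinForm.ext_basis b⟩

variable {f : LinearMap.BilinForm F V} {b : Module.Basis ι F V} {d : ι → F}

theorem mem_M_iff_entries (hsymm : f.IsSymm) {T : Module.End F V} :
    T ∈ M f ↔ ∀ i j, entries f b T i j = entries f b T j i := by
  have h : T ∈ M f ↔ f.compLeft T = f.compRight T := by
    rw [mem_M, LinearMap.BilinForm.ext_iff]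
    rfl
  rw [h, forms_eq_iff_basis b]
  simp only [entries_apply, LinearMap.BilinForm.compLeft_apply,
    LinearMap.BilinForm.compRight_apply]
  refine forall_congr' fun i => forall_congr' fun j => ?_
  rw [hsymm.eq (b j) (T (b i)), eq_comm]

theorem mem_L_iff_entries (hsymm : f.IsSymm) {T : Module.End F V} :
    T ∈ L f ↔ ∀ i j, entries f b T i j = -entries f b T j i := by
  have h : T ∈ L f ↔ f.compLeft T = -f.compRight T := by
    rw [mem_L, LinearMap.BilinForm.ext_iff]
    rfl
  rw [h, forms_eq_iff_basis b]
  simp only [entries_apply, LinearMap.BilinForm.compLeft_apply,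
    LinearMap.BilinForm.neg_apply, LinearMap.BilinForm.compRight_apply]
  refine forall_congr' fun i => forall_congr' fun j => ?_
  rw [hsymm.eq (b j) (T (b i)), eq_neg_iff_add_eq_zero, eq_neg_iff_add_eq_zero, add_comm]

variable [DecidableEq ι]

theorem apply_basis_left (hb : ∀ i j, f (b i) (b j) = if i = j then d i else 0) (i : ι) (v : V) :
    f (b i) v = d i * b.repr v i := by
  have h : f (b i) = d i • b.coord i := b.ext fun j => by
    simp [hb, Finsupp.single_apply, eq_comm]
  rw [h]
  simp

theorem diag_ne_zero (hf : f.Nondegenerate) (hb : ∀ i j, f (b i) (b j) = if i = j then d i else 0)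
    (i : ι) : d i ≠ 0 := by
  intro h
  refine b.ne_zero i (hf.1 _ fun v => ?_)
  rw [apply_basis_left hb, h, zero_mul]

theorem entries_lie (hsymm : f.IsSymm) (hb : ∀ i j, f (b i) (b j) = if i = j then d i else 0)
    (p q : ι) (T : Module.End F V) :
    entries f b ⁅skewOne f hsymm (b p) (b q), T⁆ = rotate d p q (entries f b T) := by
  ext i j
  simp only [entries_apply, lie_apply, coe_skewOne, LinearMap.sub_apply, rankOne_apply, map_sub,
    map_smul, hb, smul_eq_mul, rotate]
  grind

theorem trace_eq_sum_entries [Fintype ι]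
    (hb : ∀ i j, f (b i) (b j) = if i = j then d i else 0) (hd : ∀ i, d i ≠ 0)
    (T : Module.End F V) :
    LinearMap.trace F V T = ∑ i, (d i)⁻¹ * entries f b T i i := by
  rw [LinearMap.trace_eq_matrix_trace F b, Matrix.trace]
  refine Finset.sum_congr rfl fun i _ => ?_
  rw [entries_apply, apply_basis_left hb, inv_mul_cancel_left₀ (hd i), Matrix.diag_apply,
    LinearMap.toMatrix_apply]

theorem entries_eq_mul_toMatrix [Fintype ι]
    (hb : ∀ i j, f (b i) (b j) = if i = j then d i else 0) (T : Module.End F V) (i j : ι) :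
    entries f b T i j = d i * LinearMap.toMatrix b b T i j := by
  rw [entries_apply, apply_basis_left hb, LinearMap.toMatrix_apply]

theorem entries_bijective [Fintype ι] (hb : ∀ i j, f (b i) (b j) = if i = j then d i else 0)
    (hd : ∀ i, d i ≠ 0) : Function.Bijective (entries f b) := by
  constructor
  · intro S T h
    refine (LinearMap.toMatrix b b).injective (Matrix.ext fun i j => ?_)
    have := congrFun (congrFun h i) j
    rw [entries_eq_mul_toMatrix hb, entries_eq_mul_toMatrix hb] at this
    exact mul_left_cancel₀ (hd i) this
  · intro A
    refine ⟨Matrix.toLin b b (Matrix.of fun i j => (d i)⁻¹ * A i j), Matrix.ext fun i j => ?_⟩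
    rw [entries_eq_mul_toMatrix hb, LinearMap.toMatrix_toLin, Matrix.of_apply,
      mul_inv_cancel_left₀ (hd i)]

theorem entries_smul_one (hb : ∀ i j, f (b i) (b j) = if i = j then d i else 0) (c : F) :
    entries f b (c • (1 : Module.End F V)) = Matrix.diagonal fun i => c * d i := by
  ext i j
  simp [hb, Matrix.diagonal_apply]

theorem rotate_mem_map_entries (hsymm : f.IsSymm)
    (hb : ∀ i j, f (b i) (b j) = if i = j then d i else 0)
    (N : LieSubmodule F (L f) (Module.End F V)) (p q : ι) :
    ∀ t ∈ N.toSubmodule.map (entries f b), rotate d p q t ∈ N.toSubmodule.map (entries f b) := by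
  rintro _ ⟨T, hT, rfl⟩
  exact ⟨_, N.lie_mem (x := skewOne f hsymm (b p) (b q)) hT, entries_lie hsymm hb p q T⟩

end Coordinates

/-! ### Submodules of `gl(V)` -/

section Submodules

variable {F : Type*} [Field F] {V : Type*} [AddCommGroup V] [Module F V] [FiniteDimensional F V]
  {f : LinearMap.BilinForm F V}

theorem exists_orthogonal_basis (h2 : (2 : F) ≠ 0) (hf : f.Nondegenerate) (hsymm : f.IsSymm)
    {m : ℕ} (hdim : Module.finrank F V = m) :
    ∃ (b : Module.Basis (Fin m) F V) (d : Fin m → F),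
      (∀ i j, f (b i) (b j) = if i = j then d i else 0) ∧ ∀ i, d i ≠ 0 := by
  subst hdim
  have : Invertible (2 : F) := invertibleOfNonzero h2
  obtain ⟨b, hb⟩ := LinearMap.BilinForm.exists_orthogonal_basis (B := f) ⟨hsymm.eq⟩
  have hb' : ∀ i j, f (b i) (b j) = if i = j then f (b i) (b i) else 0 := by
    intro i j
    split_ifs with h
    · rw [h]
    · exact hb h
  exact ⟨b, fun i => f (b i) (b i), hb', diag_ne_zero hf hb'⟩

/-- In dimension at least four, an `L(f)`-submodule of `gl(V)` with a non-scalar self-adjoint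
element contains all traceless self-adjoint endomorphisms. -/
theorem M_inf_sl_le (h2 : (2 : F) ≠ 0) (hf : f.Nondegenerate) (hsymm : f.IsSymm)
    (hdim : 4 ≤ Module.finrank F V) (N : LieSubmodule F (L f) (Module.End F V))
    {T : Module.End F V} (hTN : T ∈ N) (hTM : T ∈ M f) (hT : T ∉ scalars f) :
    M f ⊓ sl f ≤ N := by
  obtain ⟨b, d, hb, hd⟩ := exists_orthogonal_basis h2 hf hsymm rfl
  intro S hS
  rw [LieSubmodule.mem_inf, mem_sl, mem_M_iff_entries (b := b) hsymm,
    trace_eq_sum_entries hb hd] at hS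
  rw [mem_M_iff_entries (b := b) hsymm] at hTM
  obtain ⟨S', hS', h⟩ := mem_of_symm_not_scalar (by simpa using hdim) h2 hd
    (rotate_mem_map_entries hsymm hb N) ⟨T, hTN, rfl⟩ hTM (fun c hc => hT (mem_scalars.2 ⟨c, by
      rw [← entries_smul_one hb] at hc
      exact ((entries_bijective hb hd).1 hc).symm⟩)) hS.1 hS.2
  rwa [← (entries_bijective hb hd).1 h]

/-- An `L(f)`-submodule of `gl(V)` with a nonzero skew-adjoint element contains all skew-adjoint
endomorphisms, in dimension three or at least five, and in dimension four when the discriminant is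
not a square. -/
theorem mem_of_mem_L (h2 : (2 : F) ≠ 0) (hf : f.Nondegenerate) (hsymm : f.IsSymm) {m : ℕ}
    (hdim : Module.finrank F V = m)
    (hm : m = 3 ∨ 5 ≤ m ∨ (m = 4 ∧ ∃ b : Module.Basis (Fin m) F V,
        ¬ IsSquare (LinearMap.BilinForm.toMatrix b f).det))
    (N : LieSubmodule F (L f) (Module.End F V))
    {T : Module.End F V} (hTN : T ∈ N) (hTL : T ∈ L f) (hT : T ≠ 0)
    {S : Module.End F V} (hS : S ∈ L f) : S ∈ N := by
  obtain ⟨b, d, hb, hd⟩ := exists_orthogonal_basis h2 hf hsymm hdim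
  have hcard : Fintype.card (Fin m) = 3 ∨ 5 ≤ Fintype.card (Fin m) ∨
      (Fintype.card (Fin m) = 4 ∧ ¬ IsSquare (∏ i, d i)) := by
    rw [Fintype.card_fin]
    refine hm.imp_right (Or.imp_right (And.imp_right ?_))
    rintro ⟨b', hb'⟩ ⟨c, hc⟩
    refine hb' ⟨c * (b.toMatrix b').det, ?_⟩
    have hdiag : LinearMap.BilinForm.toMatrix b f = Matrix.diagonal d := by
      ext i j
      rw [LinearMap.BilinForm.toMatrix_apply, hb, Matrix.diagonal_apply]
    rw [← LinearMap.BilinForm.toMatrix_mul_basis_toMatrix b b' f, Matrix.det_mul, Matrix.det_mul,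
      Matrix.det_transpose, hdiag, Matrix.det_diagonal, hc]
    ring
  rw [mem_L_iff_entries (b := b) hsymm] at hTL hS
  obtain ⟨S', hS', h⟩ := mem_of_skew_ne_zero h2 hd hcard
    (rotate_mem_map_entries hsymm hb N) ⟨T, hTN, rfl⟩ hTL
    (fun h => hT ((entries_bijective hb hd).1 (h.trans (map_zero _).symm))) hS
  rwa [← (entries_bijective hb hd).1 h]

theorem exists_mem_M_inf_sl_notMem_scalars (h2 : (2 : F) ≠ 0) (hf : f.Nondegenerate)
    (hsymm : f.IsSymm) (hdim : 2 ≤ Module.finrank F V) : ∃ T ∈ M f ⊓ sl f, T ∉ scalars f := by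
  obtain ⟨b, d, hb, hd⟩ := exists_orthogonal_basis h2 hf hsymm rfl
  obtain ⟨i, j, hij⟩ := Fintype.exists_pair_of_one_lt_card
    (show 1 < Fintype.card (Fin (Module.finrank F V)) by rw [Fintype.card_fin]; exact hdim)
  obtain ⟨T, hT⟩ := (entries_bijective hb hd).2 (symUnit F i j)
  refine ⟨T, ?_, ?_⟩
  · rw [LieSubmodule.mem_inf, mem_sl, mem_M_iff_entries (b := b) hsymm,
      trace_eq_sum_entries hb hd, hT]
    refine ⟨fun k l => ?_, Finset.sum_eq_zero fun k _ => ?_⟩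
    · grind [symUnit_apply]
    · grind [symUnit_apply]
  · rw [mem_scalars]
    rintro ⟨c, rfl⟩
    rw [entries_smul_one hb] at hT
    have := congrFun (congrFun hT i) j
    simp [symUnit_apply, hij] at this

theorem exists_mem_M_trace_eq_one (h2 : (2 : F) ≠ 0) (hf : f.Nondegenerate)
    (hsymm : f.IsSymm) (hdim : 1 ≤ Module.finrank F V) :
    ∃ T ∈ M f, LinearMap.trace F V T = 1 := by
  obtain ⟨b, d, hb, hd⟩ := exists_orthogonal_basis h2 hf hsymm rfl
  let i : Fin (Module.finrank F V) := ⟨0, hdim⟩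
  refine ⟨(d i)⁻¹ • rankOne f (b i) (b i), (M f).smul_mem _ (mem_M.2 ?_), ?_⟩
  · intro v w
    simp only [rankOne_apply, map_smul, LinearMap.smul_apply, smul_eq_mul]
    rw [hsymm.eq v (b i), mul_comm]
  · rw [map_smul, trace_rankOne, hb, if_pos rfl, smul_eq_mul, inv_mul_cancel₀ (hd i)]

/-- Symmetric matrices are functions on unordered pairs of indices. -/
theorem finrank_M (h2 : (2 : F) ≠ 0) (hf : f.Nondegenerate) (hsymm : f.IsSymm) :
    Module.finrank F (M f) = (Module.finrank F V + 1).choose 2 := by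
  obtain ⟨b, d, hb, hd⟩ := exists_orthogonal_basis h2 hf hsymm rfl
  let g : (Sym2 (Fin (Module.finrank F V)) → F) →ₗ[F]
      Matrix (Fin (Module.finrank F V)) (Fin (Module.finrank F V)) F :=
    { toFun := fun a => Matrix.of fun i j => a s(i, j)
      map_add' := fun _ _ => rfl
      map_smul' := fun _ _ => rfl }
  have hg : Function.Injective g := by
    intro a a' h
    ext z
    induction z with
    | _ i j => exact congrFun (congrFun h i) j
  have hrange : LinearMap.range g = (M f).toSubmodule.map (entries f b) := by
    ext A
    constructor
    · rintro ⟨a, rfl⟩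
      obtain ⟨T, hT⟩ := (entries_bijective hb hd).2 (g a)
      refine ⟨T, (mem_M_iff_entries (b := b) hsymm).2 fun i j => ?_, hT⟩
      rw [hT]
      change a s(i, j) = a s(j, i)
      rw [Sym2.eq_swap]
    · rintro ⟨T, hT, rfl⟩
      have hT' := (mem_M_iff_entries (b := b) hsymm).1 hT
      exact ⟨Sym2.lift ⟨fun i j => entries f b T i j, hT'⟩, rfl⟩
  have h1 := LinearMap.finrank_range_of_inj hg
  have h3 := (Submodule.equivMapOfInjective _ (entries_bijective hb hd).1
    (M f).toSubmodule).finrank_eq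
  change Module.finrank F (M f).toSubmodule = _
  rw [h3, ← hrange, h1, Module.finrank_fintype_fun_eq_card, Sym2.card, Fintype.card_fin]

theorem finrank_M_inf_sl (h2 : (2 : F) ≠ 0) (hf : f.Nondegenerate) (hsymm : f.IsSymm)
    (hdim : 1 ≤ Module.finrank F V) :
    Module.finrank F (M f ⊓ sl f : LieSubmodule F (L f) (Module.End F V)) =
      (Module.finrank F V + 1).choose 2 - 1 := by
  let g : (M f).toSubmodule →ₗ[F] F := LinearMap.trace F V ∘ₗ (M f).toSubmodule.subtype
  have hg : LinearMap.range g = ⊤ := by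
    obtain ⟨T, hT, h1⟩ := exists_mem_M_trace_eq_one h2 hf hsymm hdim
    refine LinearMap.range_eq_top.2 fun c => ⟨c • ⟨T, hT⟩, ?_⟩
    rw [map_smul]
    change c * LinearMap.trace F V T = c
    rw [h1, mul_one]
  have hker : (LinearMap.ker g).map (M f).toSubmodule.subtype = (M f ⊓ sl f).toSubmodule := by
    ext T
    constructor
    · rintro ⟨T, hT, rfl⟩
      exact ⟨T.2, hT⟩
    · rintro ⟨h1, h3⟩
      exact ⟨⟨T, h1⟩, h3, rfl⟩
  have h1 := g.finrank_range_add_finrank_ker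
  have h3 := (Submodule.equivMapOfInjective _ (M f).toSubmodule.injective_subtype
    (LinearMap.ker g)).finrank_eq
  rw [hker] at h3
  have h4 : Module.finrank F (M f).toSubmodule = _ := finrank_M h2 hf hsymm
  rw [hg, finrank_top, Module.finrank_self, h4, h3] at h1
  exact (Nat.sub_eq_of_eq_add (by rw [← h1, add_comm]; rfl)).symm

end Submodules

/-! ### Lie module generalities -/

section General

/-- A bijective homomorphism of Lie modules is an isomorphism. -/
theorem nonempty_equiv_of_bijective {R A P Q : Type*} [CommRing R] [LieRing A]
    [AddCommGroup P] [Module R P] [LieRingModule A P]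
    [AddCommGroup Q] [Module R Q] [LieRingModule A Q]
    (g : P →ₗ⁅R, A⁆ Q) (hg : Function.Bijective g) : Nonempty (P ≃ₗ⁅R, A⁆ Q) :=
  let e := LinearEquiv.ofBijective (g : P →ₗ[R] Q) hg
  ⟨{ g with
    invFun := e.symm
    left_inv := e.symm_apply_apply
    right_inv := e.apply_symm_apply }⟩

/-- Two Lie modules embedded with the same image in a third one are isomorphic. -/
theorem nonempty_equiv_of_range_eq {R A E P Q : Type*} [CommRing R] [LieRing A]
    [AddCommGroup E] [Module R E] [LieRingModule A E]
    [AddCommGroup P] [Module R P] [LieRingModule A P]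
    [AddCommGroup Q] [Module R Q] [LieRingModule A Q] (g : P →ₗ⁅R, A⁆ E) (h : Q →ₗ⁅R, A⁆ E)
    (hg : Function.Injective g) (hh : Function.Injective h)
    (hrange : Set.range g = Set.range h) : Nonempty (P ≃ₗ⁅R, A⁆ Q) := by
  have hex : ∀ p, ∃ q, h q = g p := fun p => by
    have : g p ∈ Set.range h := hrange ▸ Set.mem_range_self p
    exact this
  choose k hk using hex
  let k' : P →ₗ⁅R, A⁆ Q :=
    { toFun := k
      map_add' := fun a b => hh (by rw [map_add, hk, hk, hk, map_add])
      map_smul' := fun c a => hh (by rw [hk, map_smul, map_smul, hk, RingHom.id_apply])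
      map_lie' := fun {x a} => hh (by
        rw [hk, LieModuleHom.map_lie, LieModuleHom.map_lie, hk]) }
  refine nonempty_equiv_of_bijective k' ⟨fun a b hab => hg ?_, fun q => ?_⟩
  · rw [← hk, ← hk]
    exact congrArg h hab
  · obtain ⟨p, hp⟩ : h q ∈ Set.range g := hrange ▸ Set.mem_range_self q
    exact ⟨p, hh ((hk p).trans hp)⟩

variable {R A E : Type*} [CommRing R] [LieRing A] [LieAlgebra R A]
  [AddCommGroup E] [Module R E] [LieRingModule A E] [LieModule R A E]

/-- First isomorphism theorem for Lie modules. -/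
theorem nonempty_quotient_equiv_of_surjective {Q : Type*} [AddCommGroup Q] [Module R Q]
    [LieRingModule A Q] (K : LieSubmodule R A E) (g : E →ₗ⁅R, A⁆ Q) (hg : Function.Surjective g)
    (hK : ∀ x, g x = 0 ↔ x ∈ K) : Nonempty ((E ⧸ K) ≃ₗ⁅R, A⁆ Q) := by
  let h : (E ⧸ K) →ₗ⁅R, A⁆ Q :=
    { K.toSubmodule.liftQ (g : E →ₗ[R] Q) fun x hx => (hK x).2 hx with
      map_lie' := by
        intro a x
        obtain ⟨x, rfl⟩ := LieSubmodule.Quotient.surjective_mk' K x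
        exact LieModuleHom.map_lie g a x }
  have hh : ∀ x, h (LieSubmodule.Quotient.mk' K x) = g x := fun _ => rfl
  refine nonempty_equiv_of_bijective h ⟨(injective_iff_map_eq_zero _).2 fun x hx => ?_, fun q => ?_⟩
  · obtain ⟨x, rfl⟩ := LieSubmodule.Quotient.surjective_mk' K x
    rw [hh, hK] at hx
    exact (LieSubmodule.Quotient.mk_eq_zero _).2 hx
  · obtain ⟨x, rfl⟩ := hg q
    exact ⟨_, hh x⟩

omit [LieAlgebra R A] [LieModule R A E] in
theorem exists_mem_ne_zero_of_ne_bot {N : LieSubmodule R A E} (h : N ≠ ⊥) : ∃ x ∈ N, x ≠ 0 :=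
  N.toSubmodule.exists_mem_ne_zero_of_ne_bot fun e => h ((LieSubmodule.toSubmodule_eq_bot N).1 e)

omit [LieAlgebra R A] [LieModule R A E] in
theorem isIrreducible_of_forall_le {W : LieSubmodule R A E} (hW : ∃ x ∈ W, x ≠ 0)
    (h : ∀ N : LieSubmodule R A E, N ≤ W → ∀ T ∈ N, T ≠ 0 → W ≤ N) :
    LieModule.IsIrreducible R A W := by
  obtain ⟨x, hx, hx0⟩ := hW
  have : Nontrivial W := ⟨⟨⟨x, hx⟩, 0, fun e => hx0 (congrArg Subtype.val e)⟩⟩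
  refine LieModule.IsIrreducible.mk fun N hN => ?_
  obtain ⟨T, hT, hT0⟩ := exists_mem_ne_zero_of_ne_bot hN
  have hle := h (N.map W.incl) (LieSubmodule.map_incl_le) T (LieSubmodule.mem_map_of_mem hT)
    (fun e => hT0 (Subtype.ext e))
  refine eq_top_iff.2 fun S _ => ?_
  obtain ⟨S', hS', e⟩ := LieSubmodule.mem_map _ |>.1 (hle S.2)
  rwa [← (Subtype.ext e : S' = S)]

/-- Irreducibility of `W / U`, in terms of the submodules of `E` between `U` and `W`. -/
theorem isIrreducible_factor_of_forall_le {U W : LieSubmodule R A E} (hUW : U ≤ W)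
    (hW : ∃ x ∈ W, x ∉ U)
    (h : ∀ N : LieSubmodule R A E, N ≤ W → U ≤ N → ∀ T ∈ N, T ∉ U → W ≤ N) :
    LieModule.IsIrreducible R A (Factor U W) := by
  obtain ⟨x, hx, hxU⟩ := hW
  let π := LieSubmodule.Quotient.mk' (U.comap W.incl)
  have hπ : ∀ w : W, π w = 0 ↔ (w : E) ∈ U := fun w => LieSubmodule.Quotient.mk_eq_zero _
  have hsurj : Function.Surjective π := LieSubmodule.Quotient.surjective_mk' _
  have : Nontrivial (Factor U W) := ⟨⟨π ⟨x, hx⟩, 0, fun e => hxU ((hπ _).1 e)⟩⟩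
  refine LieModule.IsIrreducible.mk fun N hN => ?_
  obtain ⟨t, ht, ht0⟩ := exists_mem_ne_zero_of_ne_bot hN
  obtain ⟨T, rfl⟩ := hsurj t
  have hle := h ((N.comap π).map W.incl) LieSubmodule.map_incl_le (fun u hu => by
      refine (LieSubmodule.mem_map _).2 ⟨⟨u, hUW hu⟩, ?_, rfl⟩
      rw [LieSubmodule.mem_comap, (hπ _).2 hu]
      exact N.zero_mem) T
    ((LieSubmodule.mem_map _).2 ⟨T, ht, rfl⟩) (fun e => ht0 ((hπ T).2 e))
  refine eq_top_iff.2 fun s _ => ?_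
  obtain ⟨S, rfl⟩ := hsurj s
  obtain ⟨S', hS', e⟩ := (LieSubmodule.mem_map _).1 (hle S.2)
  rw [← (Subtype.ext e : S' = S)]
  exact hS'

theorem isIrreducible_factor_bot {W : LieSubmodule R A E} (hW : ∃ x ∈ W, x ≠ 0)
    (h : ∀ N : LieSubmodule R A E, N ≤ W → ∀ T ∈ N, T ≠ 0 → W ≤ N) :
    LieModule.IsIrreducible R A (Factor ⊥ W) :=
  isIrreducible_factor_of_forall_le bot_le (by simpa using hW)
    fun N hN _ T hT hT0 => h N hN T hT (by simpa using hT0)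

theorem finrank_factor {F A E : Type*} [Field F] [LieRing A] [LieAlgebra F A] [AddCommGroup E]
    [Module F E] [LieRingModule A E] [LieModule F A E] [FiniteDimensional F E]
    {U W : LieSubmodule F A E} (hUW : U ≤ W) :
    Module.finrank F (Factor U W) = Module.finrank F W - Module.finrank F U := by
  have h1 := Submodule.finrank_quotient (U.comap W.incl).toSubmodule (R := F)
  have h2 : Module.finrank F (U.comap W.incl).toSubmodule = Module.finrank F U :=
    (Submodule.comapSubtypeEquivOfLe (p := U.toSubmodule) (q := W.toSubmodule) hUW).finrank_eq
  rw [h2] at h1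
  exact h1

end General

/-! ### The `L(f)`-module structure of `gl(V)` -/

section Structure

variable {F : Type*} [Field F] {V : Type*} [AddCommGroup V] [Module F V] [FiniteDimensional F V]
  {f : LinearMap.BilinForm F V}

theorem eq_zero_of_mem_scalars_of_mem_sl (hm : (Module.finrank F V : F) ≠ 0)
    {T : Module.End F V} (hT : T ∈ scalars f) (hsl : T ∈ sl f) : T = 0 := by
  obtain ⟨c, rfl⟩ := mem_scalars.1 hT
  rw [mem_sl, map_smul, LinearMap.trace_one, smul_eq_mul] at hsl
  rw [(mul_eq_zero.1 hsl).resolve_right hm, zero_smul]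

theorem scalars_le (hm : (Module.finrank F V : F) = 0) : scalars f ≤ M f ⊓ sl f := by
  intro T hT
  obtain ⟨c, rfl⟩ := mem_scalars.1 hT
  refine mem_M_inf_sl.2 ⟨fun v w => by simp, ?_⟩
  rw [map_smul, LinearMap.trace_one, hm, smul_zero]

theorem M_inf_sl_le_of_mem (h2 : (2 : F) ≠ 0) (hf : f.Nondegenerate) (hsymm : f.IsSymm)
    (hdim : 4 ≤ Module.finrank F V) (hm : (Module.finrank F V : F) ≠ 0)
    (N : LieSubmodule F (L f) (Module.End F V)) (hN : N ≤ M f ⊓ sl f) (T : Module.End F V)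
    (hT : T ∈ N) (hT0 : T ≠ 0) : M f ⊓ sl f ≤ N :=
  M_inf_sl_le h2 hf hsymm hdim N hT (hN hT).1
    fun h => hT0 (eq_zero_of_mem_scalars_of_mem_sl hm h (hN hT).2)

theorem exists_mem_M_inf_sl_ne_zero (h2 : (2 : F) ≠ 0) (hf : f.Nondegenerate)
    (hsymm : f.IsSymm) (hdim : 2 ≤ Module.finrank F V) : ∃ T ∈ M f ⊓ sl f, T ≠ 0 := by
  obtain ⟨T, hT, hTs⟩ := exists_mem_M_inf_sl_notMem_scalars h2 hf hsymm hdim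
  exact ⟨T, hT, fun h => hTs (h ▸ zero_mem _)⟩

theorem isIrreducible_factor_scalars (h2 : (2 : F) ≠ 0) (hf : f.Nondegenerate)
    (hsymm : f.IsSymm) (hdim : 4 ≤ Module.finrank F V) (hm : (Module.finrank F V : F) = 0) :
    LieModule.IsIrreducible F (L f) (Factor (scalars f) (M f ⊓ sl f)) :=
  isIrreducible_factor_of_forall_le (scalars_le hm)
    (exists_mem_M_inf_sl_notMem_scalars h2 hf hsymm (by omega))
    fun N hN _ _ hT hTs => M_inf_sl_le h2 hf hsymm hdim N hT (hN hT).1 hTs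

omit [FiniteDimensional F V] in
theorem isIrreducible_scalars [Nontrivial V] :
    LieModule.IsIrreducible F (L f) (Factor ⊥ (scalars f)) := by
  refine isIrreducible_factor_bot ⟨1, mem_scalars.2 ⟨1, one_smul _ _⟩, one_ne_zero⟩ ?_
  intro N hN T hT hT0 S hS
  obtain ⟨c, rfl⟩ := mem_scalars.1 (hN hT)
  obtain ⟨e, rfl⟩ := mem_scalars.1 hS
  have hc : c ≠ 0 := fun h => hT0 (by rw [h, zero_smul])
  have h := N.smul_mem (e * c⁻¹) hT
  rwa [smul_smul, inv_mul_cancel_right₀ hc] at h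

theorem isIrreducible_M_factor (h2 : (2 : F) ≠ 0) (hf : f.Nondegenerate) (hsymm : f.IsSymm)
    (hdim : 1 ≤ Module.finrank F V) :
    LieModule.IsIrreducible F (L f) (Factor (M f ⊓ sl f) (M f)) := by
  obtain ⟨T₁, hT₁, htr⟩ := exists_mem_M_trace_eq_one h2 hf hsymm hdim
  refine isIrreducible_factor_of_forall_le inf_le_left
    ⟨T₁, hT₁, fun h => one_ne_zero (htr.symm.trans (mem_M_inf_sl.1 h).2)⟩ ?_
  intro N hN hle T hT hTn S hS
  have hT0 : LinearMap.trace F V T ≠ 0 := fun h => hTn (mem_M_inf_sl.2 ⟨hN hT, h⟩)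
  set c := LinearMap.trace F V S * (LinearMap.trace F V T)⁻¹
  have h : S - c • T ∈ M f ⊓ sl f := by
    refine mem_M_inf_sl.2 ⟨(M f).sub_mem hS ((M f).smul_mem c (hN hT)), ?_⟩
    rw [map_sub, map_smul, smul_eq_mul, inv_mul_cancel_right₀ hT0, sub_self]
  simpa using N.add_mem (hle h) (N.smul_mem c hT)

/-- The inclusion of the adjoint module `L(f)` in `gl(V)`. -/
def inclL (f : LinearMap.BilinForm F V) : L f →ₗ⁅F, L f⁆ Module.End F V where
  __ := (L f).toSubmodule.subtype
  map_lie' := rfl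

omit [FiniteDimensional F V] in
theorem inclL_injective : Function.Injective (inclL f) := Subtype.val_injective

theorem exists_lie_ne_zero (h2 : (2 : F) ≠ 0) (hf : f.Nondegenerate) (hsymm : f.IsSymm)
    (hdim : 3 ≤ Module.finrank F V) : ∃ x y : L f, ⁅x, y⁆ ≠ 0 := by
  obtain ⟨b, d, hb, hd⟩ := exists_orthogonal_basis h2 hf hsymm rfl
  obtain ⟨p, q, r, hpq, hpr, hqr⟩ := Fintype.two_lt_card_iff.1
    (show 2 < Fintype.card (Fin (Module.finrank F V)) by rw [Fintype.card_fin]; exact hdim)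
  obtain ⟨T, hT⟩ := (entries_bijective hb hd).2 (skewUnit F p q)
  have hTL : T ∈ L f := (mem_L_iff_entries (b := b) hsymm).2 fun i j => by
    rw [hT]
    grind [skewUnit_apply]
  refine ⟨skewOne f hsymm (b r) (b p), ⟨T, hTL⟩, fun h => ?_⟩
  have h1 := entries_lie hsymm hb r p T
  rw [hT, rotate_skewUnit hpq hpr.symm hqr.symm] at h1
  have h3 : ⁅skewOne f hsymm (b r) (b p), T⁆ = 0 := congrArg Subtype.val h
  rw [h3, map_zero] at h1
  have := congrFun (congrFun h1 r) q
  simp [skewUnit_apply, hqr.symm] at this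
  exact hd r this.symm

theorem isSimple_L (h2 : (2 : F) ≠ 0) (hf : f.Nondegenerate) (hsymm : f.IsSymm) {m : ℕ}
    (hdim : Module.finrank F V = m) (hm : m = 3 ∨ 5 ≤ m) : LieAlgebra.IsSimple F (L f) where
  eq_bot_or_eq_top := by
    intro I
    refine or_iff_not_imp_left.2 fun hI => eq_top_iff.2 fun y _ => ?_
    obtain ⟨x, hx, hx0⟩ := exists_mem_ne_zero_of_ne_bot hI
    have h := mem_of_mem_L h2 hf hsymm hdim (hm.imp_right Or.inl) (LieSubmodule.map (inclL f) I)
      ((LieSubmodule.mem_map _).2 ⟨x, hx, rfl⟩) x.2 (fun h => hx0 (Subtype.ext h)) y.2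
    obtain ⟨y', hy', e⟩ := (LieSubmodule.mem_map _).1 h
    rwa [← inclL_injective e]
  non_abelian := by
    intro h
    obtain ⟨x, y, hxy⟩ := exists_lie_ne_zero h2 hf hsymm (by omega)
    exact hxy (h.trivial x y)

/-- As `gl(V) = M(f) ⊕ L(f)`, submodules above `M(f)` are determined by their intersection with
`L(f)`. -/
theorem isIrreducible_top_factor (h2 : (2 : F) ≠ 0) (hf : f.Nondegenerate) (hsymm : f.IsSymm)
    {m : ℕ} (hdim : Module.finrank F V = m)
    (hm : 5 ≤ m ∨ (m = 4 ∧ ∃ b : Module.Basis (Fin m) F V,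
        ¬ IsSquare (LinearMap.BilinForm.toMatrix b f).det)) :
    LieModule.IsIrreducible F (L f) (Factor (M f) ⊤) := by
  obtain ⟨x, y, hxy⟩ := exists_lie_ne_zero h2 hf hsymm (by omega)
  refine isIrreducible_factor_of_forall_le le_top ⟨(⁅x, y⁆ : L f), trivial, fun h =>
    hxy (Subtype.ext (eq_zero_of_mem_M_of_mem_L h2 hf h (⁅x, y⁆ : L f).2))⟩ ?_
  intro N _ hle T hT hTM S _
  obtain ⟨a, ha, t, rfl⟩ := exists_mem_M_add_mem_L h2 hf hsymm T
  obtain ⟨a', ha', s, rfl⟩ := exists_mem_M_add_mem_L h2 hf hsymm S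
  have ht : (t : Module.End F V) ∈ N := by
    simpa using N.sub_mem hT (hle ha)
  refine N.add_mem (hle ha') (mem_of_mem_L h2 hf hsymm hdim (Or.inr hm) N ht t.2 ?_ s.2)
  intro h
  rw [h, add_zero] at hTM
  exact hTM ha

/-! ### Isomorphisms of `L(f)`-modules -/

theorem nonempty_M_equiv_symSq (h2 : (2 : F) ≠ 0) (hf : f.Nondegenerate) (hsymm : f.IsSymm) :
    Nonempty (M f ≃ₗ⁅F, L f⁆ symSq f) := by
  have hbij := tensorToEnd_bijective hf
  refine nonempty_equiv_of_range_eq (M f).incl ((tensorToEnd f).comp (symSq f).incl)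
    Subtype.val_injective (hbij.1.comp Subtype.val_injective) ?_
  ext y
  constructor
  · rintro ⟨y, rfl⟩
    obtain ⟨t, ht⟩ := hbij.2 y
    exact ⟨⟨t, (tensorToEnd_mem_M_iff h2 hf hsymm).1 (by rw [ht]; exact y.2)⟩, ht⟩
  · rintro ⟨t, rfl⟩
    exact ⟨⟨_, (tensorToEnd_mem_M_iff h2 hf hsymm).2 t.2⟩, rfl⟩

theorem nonempty_M_inf_sl_equiv_ker (h2 : (2 : F) ≠ 0) (hf : f.Nondegenerate)
    (hsymm : f.IsSymm) :
    Nonempty ((M f ⊓ sl f : LieSubmodule F (L f) (Module.End F V)) ≃ₗ⁅F, L f⁆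
      (symContraction f).ker) := by
  have hbij := tensorToEnd_bijective hf
  have htr : ∀ t, LinearMap.trace F V (tensorToEnd f t) = 0 ↔ contraction f t = 0 := by
    intro t
    rw [trace_tensorToEnd hsymm, LinearEquiv.map_eq_zero_iff]
  refine nonempty_equiv_of_range_eq (M f ⊓ sl f).incl
    (((tensorToEnd f).comp (symSq f).incl).comp (symContraction f).ker.incl)
    Subtype.val_injective
    ((hbij.1.comp Subtype.val_injective).comp Subtype.val_injective) ?_
  ext y
  constructor
  · rintro ⟨y, rfl⟩
    obtain ⟨t, ht⟩ := hbij.2 y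
    have hy := mem_M_inf_sl.1 y.2
    rw [← ht, htr] at hy
    exact ⟨⟨⟨t, (tensorToEnd_mem_M_iff h2 hf hsymm).1 hy.1⟩, hy.2⟩, ht⟩
  · rintro ⟨t, rfl⟩
    exact ⟨⟨_, mem_M_inf_sl.2 ⟨(tensorToEnd_mem_M_iff h2 hf hsymm).2 t.1.2, (htr _).2 t.2⟩⟩, rfl⟩

theorem nonempty_L_equiv_extSq (h2 : (2 : F) ≠ 0) (hf : f.Nondegenerate) (hsymm : f.IsSymm) :
    Nonempty (L f ≃ₗ⁅F, L f⁆ extSq f) := by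
  have hbij := tensorToEnd_bijective hf
  refine nonempty_equiv_of_range_eq (inclL f) ((tensorToEnd f).comp (extSq f).incl)
    inclL_injective (hbij.1.comp Subtype.val_injective) ?_
  ext y
  constructor
  · rintro ⟨y, rfl⟩
    obtain ⟨t, ht⟩ := hbij.2 y
    exact ⟨⟨t, (tensorToEnd_mem_L_iff h2 hf hsymm).1 (by rw [ht]; exact y.2)⟩, ht⟩
  · rintro ⟨t, rfl⟩
    exact ⟨⟨_, (tensorToEnd_mem_L_iff h2 hf hsymm).2 t.2⟩, rfl⟩

theorem nonempty_L_equiv_quotient (h2 : (2 : F) ≠ 0) (hf : f.Nondegenerate)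
    (hsymm : f.IsSymm) : Nonempty (L f ≃ₗ⁅F, L f⁆ (Module.End F V ⧸ M f)) := by
  refine nonempty_equiv_of_bijective ((LieSubmodule.Quotient.mk' (M f)).comp (inclL f)) ⟨?_, ?_⟩
  · refine (injective_iff_map_eq_zero _).2 fun x hx => Subtype.ext ?_
    exact eq_zero_of_mem_M_of_mem_L h2 hf ((LieSubmodule.Quotient.mk_eq_zero _).1 hx) x.2
  · intro s
    obtain ⟨S, rfl⟩ := LieSubmodule.Quotient.surjective_mk' _ s
    obtain ⟨a, ha, x, rfl⟩ := exists_mem_M_add_mem_L h2 hf hsymm S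
    refine ⟨x, ?_⟩
    rw [map_add, (LieSubmodule.Quotient.mk_eq_zero _).2 ha, zero_add]
    rfl

/-- The trace as a homomorphism from `M(f)` to the trivial module. -/
noncomputable def traceM (f : LinearMap.BilinForm F V) : M f →ₗ⁅F, L f⁆ Triv f where
  __ := (TrivialLieModule.equiv F (L f) F).symm.toLinearMap ∘ₗ
    LinearMap.trace F V ∘ₗ (M f).toSubmodule.subtype
  map_lie' := by
    intro x y
    change LinearMap.trace F V ⁅x, (y : Module.End F V)⁆ = (0 : F)
    rw [lie_gl, map_sub, LinearMap.trace_mul_comm, sub_self]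

/-- The trace induces an isomorphism of `M(f) / (M(f) ∩ sl(V))` with the trivial module. -/
theorem nonempty_M_factor_equiv_triv (h2 : (2 : F) ≠ 0) (hf : f.Nondegenerate)
    (hsymm : f.IsSymm) (hdim : 1 ≤ Module.finrank F V) :
    Nonempty (Factor (M f ⊓ sl f) (M f) ≃ₗ⁅F, L f⁆ Triv f) := by
  obtain ⟨T, hT, htr⟩ := exists_mem_M_trace_eq_one h2 hf hsymm hdim
  refine nonempty_quotient_equiv_of_surjective _ (traceM f)
    (fun c => ⟨TrivialLieModule.equiv F (L f) F c • ⟨T, hT⟩, ?_⟩)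
    fun y => ⟨fun h => ⟨y.2, h⟩, fun h => h.2⟩
  rw [map_smul]
  change TrivialLieModule.equiv F (L f) F c * LinearMap.trace F V T = c
  rw [htr]
  exact mul_one _

omit [FiniteDimensional F V] in
theorem symContraction_symMul (h2 : (2 : F) ≠ 0) (hsymm : f.IsSymm) (v w : V) :
    symContraction f (symMul f v w) = (TrivialLieModule.equiv F (L f) F).symm (f v w) := by
  change TensorProduct.lift f ((2 : F)⁻¹ • (v ⊗ₜ[F] w + w ⊗ₜ[F] v)) = f v w
  rw [map_smul, map_add, TensorProduct.lift.tmul, TensorProduct.lift.tmul, hsymm.eq w v,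
    ← two_smul F, inv_smul_smul₀ h2]

theorem symContraction_surjective (h2 : (2 : F) ≠ 0) (hf : f.Nondegenerate) (hsymm : f.IsSymm)
    (hdim : 1 ≤ Module.finrank F V) : Function.Surjective (symContraction f) := by
  obtain ⟨b, d, hb, hd⟩ := exists_orthogonal_basis h2 hf hsymm rfl
  let i : Fin (Module.finrank F V) := ⟨0, hdim⟩
  intro c
  refine ⟨(TrivialLieModule.equiv F (L f) F c * (d i)⁻¹) • symMul f (b i) (b i), ?_⟩
  rw [map_smul, symContraction_symMul h2 hsymm, hb, if_pos rfl, ← map_smul, smul_eq_mul,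
    inv_mul_cancel_right₀ (hd i), LinearEquiv.symm_apply_apply]

/-! ### Matrices of self-adjoint endomorphisms -/

omit [FiniteDimensional F V] in
theorem image_toMatrix_M {ι : Type*} [Fintype ι] [DecidableEq ι] (hsymm : f.IsSymm)
    {b : Module.Basis ι F V} {d : ι → F}
    (hb : ∀ i j, f (b i) (b j) = if i = j then d i else 0) :
    LinearMap.toMatrix b b '' (M f : Set (Module.End F V)) =
      {A | ∀ i j, d i * A i j = d j * A j i} := by
  ext A
  obtain ⟨T, rfl⟩ := (LinearMap.toMatrix b b).surjective A
  rw [(LinearMap.toMatrix b b).injective.mem_set_image, SetLike.mem_coe,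
    mem_M_iff_entries (b := b) hsymm]
  simp only [entries_eq_mul_toMatrix hb, Set.mem_ofPred_eq]

omit [FiniteDimensional F V] in
theorem image_toMatrix_M_inf_sl {ι : Type*} [Fintype ι] [DecidableEq ι] (hsymm : f.IsSymm)
    {b : Module.Basis ι F V} {d : ι → F}
    (hb : ∀ i j, f (b i) (b j) = if i = j then d i else 0) :
    LinearMap.toMatrix b b '' ((M f ⊓ sl f : LieSubmodule F (L f) (Module.End F V)) :
        Set (Module.End F V)) =
      {A | (∀ i j, d i * A i j = d j * A j i) ∧ A.trace = 0} := by
  ext A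
  obtain ⟨T, rfl⟩ := (LinearMap.toMatrix b b).surjective A
  rw [(LinearMap.toMatrix b b).injective.mem_set_image, SetLike.mem_coe, LieSubmodule.mem_inf,
    mem_M_iff_entries (b := b) hsymm, mem_sl, LinearMap.trace_eq_matrix_trace F b]
  simp only [entries_eq_mul_toMatrix hb, Set.mem_ofPred_eq]

end Structure

end OrthogonalGl

theorem theorem1p4 {F : Type*} [Field F] {V : Type*} [AddCommGroup V] [Module F V]
    [FiniteDimensional F V] (ℓ m : ℕ) [CharP F ℓ] (hℓ : ℓ ≠ 2)
    (hdim : Module.finrank F V = m) (hm : 2 ≤ m)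
    (f : LinearMap.BilinForm F V) (hf : f.Nondegenerate) (hsymm : f.IsSymm) :
    -- (1): the orthogonal complement
    (M f).toSubmodule = (trForm F V).orthogonal (L f).toSubmodule ∧
    -- (1), (2): the matrix descriptions
    (∃ (b : Module.Basis (Fin m) F V) (d : Fin m → F),
      LinearMap.BilinForm.toMatrix b f = Matrix.diagonal d ∧
      LinearMap.toMatrix b b '' (M f : Set (Module.End F V)) =
        {A | ∀ i j, d i * A i j = d j * A j i} ∧
      LinearMap.toMatrix b b '' ((M f ⊓ sl f : LieSubmodule F (L f) (Module.End F V)) :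
          Set (Module.End F V)) =
        {A | (∀ i j, d i * A i j = d j * A j i) ∧ A.trace = 0}) ∧
    -- (1): the symmetric square
    Nonempty (M f ≃ₗ⁅F, L f⁆ symSq f) ∧
    -- (2): the contraction
    (∀ v w, symContraction f (symMul f v w) = (TrivialLieModule.equiv F (L f) F).symm (f v w)) ∧
    Function.Surjective (symContraction f) ∧
    Nonempty ((M f ⊓ sl f : LieSubmodule F (L f) (Module.End F V)) ≃ₗ⁅F, L f⁆
      (symContraction f).ker) ∧
    -- (3)
    (4 ≤ m → ¬ ℓ ∣ m →
      LieModule.IsIrreducible F (L f) (M f ⊓ sl f : LieSubmodule F (L f) (Module.End F V)) ∧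
      Module.finrank F (M f ⊓ sl f : LieSubmodule F (L f) (Module.End F V)) =
        (m + 1).choose 2 - 1) ∧
    -- (4)
    (4 ≤ m → ℓ ∣ m →
      scalars f ≤ M f ⊓ sl f ∧
      LieModule.IsIrreducible F (L f) (Factor (scalars f) (M f ⊓ sl f)) ∧
      Module.finrank F (Factor (scalars f) (M f ⊓ sl f)) = (m + 1).choose 2 - 2) ∧
    -- (5)
    (m = 3 ∨ 5 ≤ m →
      LieAlgebra.IsSimple F (L f) ∧
      Nonempty (L f ≃ₗ⁅F, L f⁆ (Module.End F V ⧸ M f)) ∧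
      Nonempty (L f ≃ₗ⁅F, L f⁆ extSq f)) ∧
    -- (6): for `m = 4` the discriminant of `f` has to be a non-square
    ((5 ≤ m ∨ (m = 4 ∧ ∃ b : Module.Basis (Fin m) F V,
        ¬ IsSquare (LinearMap.BilinForm.toMatrix b f).det)) →
      (ℓ ∣ m → IsCompSeries ![⊥, scalars f, M f ⊓ sl f, M f, ⊤]) ∧
      (¬ ℓ ∣ m → IsCompSeries ![⊥, M f ⊓ sl f, M f, ⊤])) ∧
    Nonempty (Factor (M f ⊓ sl f) (M f) ≃ₗ⁅F, L f⁆ Triv f) := by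
  have h2 : (2 : F) ≠ 0 := by
    intro h
    have h' : ((2 : ℕ) : F) = 0 := by exact_mod_cast h
    rcases (Nat.dvd_prime Nat.prime_two).1 ((CharP.cast_eq_zero_iff F ℓ 2).1 h') with h1 | h1
    · exact CharP.char_ne_one F ℓ h1
    · exact hℓ h1
  have hcast : (Module.finrank F V : F) = 0 ↔ ℓ ∣ m := by
    rw [hdim, CharP.cast_eq_zero_iff F ℓ m]
  have hnt : Nontrivial V := Module.nontrivial_of_finrank_pos (R := F) (by omega)
  refine ⟨M_eq_orthogonal h2 hf hsymm, ?_, nonempty_M_equiv_symSq h2 hf hsymm,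
    symContraction_symMul h2 hsymm, symContraction_surjective h2 hf hsymm (by omega),
    nonempty_M_inf_sl_equiv_ker h2 hf hsymm, ?_, ?_, ?_, ?_,
    nonempty_M_factor_equiv_triv h2 hf hsymm (by omega)⟩
  · obtain ⟨b, d, hb, -⟩ := exists_orthogonal_basis h2 hf hsymm hdim
    refine ⟨b, d, ?_, image_toMatrix_M hsymm hb, image_toMatrix_M_inf_sl hsymm hb⟩
    ext i j
    rw [LinearMap.BilinForm.toMatrix_apply, hb, Matrix.diagonal_apply]
  · intro hm4 hℓm
    refine ⟨isIrreducible_of_forall_le (exists_mem_M_inf_sl_ne_zero h2 hf hsymm (by omega))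
      (M_inf_sl_le_of_mem h2 hf hsymm (by omega) (mt hcast.1 hℓm)), ?_⟩
    rw [finrank_M_inf_sl h2 hf hsymm (by omega), hdim]
  · intro hm4 hℓm
    have h0 := hcast.2 hℓm
    refine ⟨scalars_le h0, isIrreducible_factor_scalars h2 hf hsymm (by omega) h0, ?_⟩
    have h1 : Module.finrank F (scalars f) = 1 :=
      finrank_span_singleton (one_ne_zero : (1 : Module.End F V) ≠ 0)
    rw [finrank_factor (scalars_le h0), finrank_M_inf_sl h2 hf hsymm (by omega), hdim, h1,
      Nat.sub_sub]
  · intro hm'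
    exact ⟨isSimple_L h2 hf hsymm hdim hm', nonempty_L_equiv_quotient h2 hf hsymm,
      nonempty_L_equiv_extSq h2 hf hsymm⟩
  · intro hm'
    have hM := isIrreducible_M_factor h2 hf hsymm (by omega)
    have htop := isIrreducible_top_factor h2 hf hsymm hdim hm'
    constructor
    · intro hℓm
      have h0 := hcast.2 hℓm
      refine ⟨rfl, rfl, fun i => ?_⟩
      fin_cases i
      · exact ⟨bot_le, isIrreducible_scalars⟩
      · exact ⟨scalars_le h0, isIrreducible_factor_scalars h2 hf hsymm (by omega) h0⟩
      · exact ⟨inf_le_left, hM⟩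
      · exact ⟨le_top, htop⟩
    · intro hℓm
      refine ⟨rfl, rfl, fun i => ?_⟩
      fin_cases i
      · exact ⟨bot_le, isIrreducible_factor_bot
          (exists_mem_M_inf_sl_ne_zero h2 hf hsymm (by omega))
          (M_inf_sl_le_of_mem h2 hf hsymm (by omega) (mt hcast.1 hℓm))⟩
      · exact ⟨inf_le_left, hM⟩
      · exact ⟨le_top, htop⟩
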